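/- Let $\Sigma$ be a set of labels with a metric $p$ (for instance a finite alphabet). Consider finite ordered forests with nodes labeled in $\Sigma$; an ordered labeled tree is such a forest with exactly one root, and it is binary if every node has at most two children. A gap in a forest is a non-empty connected set of nodes. Deleting a gap removes its nodes; the subtrees hanging from it become, in order and in the place of the top node of the gap, children of the parent of that top node (roots, if the top node was a root). Inserting a gap is the reverse operation. Fix reals $a\ge 0$ and $b>0$. Deleting or inserting a gap with $k\ge 1$ nodes costs $w(k)=a+bk$; changing the label of a node from $x$ to $y$ costs $p(x,y)$. For ordered labeled trees $T_1,T_2$, the general gap edit distance $\gamma(T_1,T_2)$ is the minimum total cost of a finite sequence of relabelings, gap deletions and gap insertions that transforms $T_1$ into $T_2$. Theorem. There is a deterministic algorithm which, for all $\Sigma,p,a,b$ as above and all ordered labeled binary trees $T_1,T_2$ with $m\ge 1$ and $n\ge 1$ nodes respectively, computes $\gamma(T_1,T_2)$ (in particular the minimum exists) in time $O(m^3n^2+m^2n^3)$; if $m\ge n$, its running time is $O(m^5)$. The implied constants are absolute. Here the algorithm is a single fixed program of a random access machine with natural-number and real memory. Natural numbers are added, subtracted and compared, reals are copied, added and compared,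 and every operation and memory access takes unit time. The input consists of $m$, $n$, $a$, $b$, for each tree the list of the numbers of children of its nodes in preorder, and the $m\times n$ table of the values $p(x_i,y_j)$, where $x_i$ and $y_j$ are the labels of the $i$-th node of $T_1$ and the $j$-th node of $T_2$ in preorder. -/

import Mathlib

/-! ## Ordered labeled trees and forests -/

/-- A finite ordered forest with nodes labeled in `Λ`: it is empty, or it consists of a first
(leftmost) tree, given by the label of its root and the ordered forest of the subtrees hanging
below that root, followed by the ordered forest of the remaining trees. -/
inductive OForest (Λ : Type*) where
  | nil : OForest Λ
  | cons (label : Λ) (children : OForest Λ) (rest : OForest Λ) : OForest Λ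

/-- A (non-empty) ordered labeled tree: a root label and the ordered forest below the root. -/
structure OTree (Λ : Type*) where
  label : Λ
  children : OForest Λ

namespace OForest

variable {Λ : Type*}

/-- Juxtaposition: the trees of the first forest followed by those of the second. -/
def append : OForest Λ → OForest Λ → OForest Λ
  | nil, G => G
  | cons x c r, G => cons x c (append r G)

/-- Number of nodes. -/
def size : OForest Λ → ℕ
  | nil => 0
  | cons _ c r => 1 + size c + size r

/-- Number of trees (that is, of roots) of the forest. -/
def numRoots : OForest Λ → ℕ
  | nil => 0
  | cons _ _ r => 1 + numRoots r

/-- Every node has at most two children. -/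
def IsBinary : OForest Λ → Prop
  | nil => True
  | cons _ c r => numRoots c ≤ 2 ∧ IsBinary c ∧ IsBinary r

/-- The labels of the nodes, in preorder. -/
def preorderLabels : OForest Λ → List Λ
  | nil => []
  | cons x c r => x :: (preorderLabels c ++ preorderLabels r)

/-- The numbers of children of the nodes, in preorder. -/
def preorderDegrees : OForest Λ → List ℕ
  | nil => []
  | cons _ c r => numRoots c :: (preorderDegrees c ++ preorderDegrees r)

end OForest

namespace OTree

variable {Λ : Type*}

/-- A tree as a forest with one root. -/
def toForest (T : OTree Λ) : OForest Λ := OForest.cons T.label T.children OForest.nil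

/-- Number of nodes. -/
def size (T : OTree Λ) : ℕ := T.toForest.size

/-- Every node has at most two children. -/
def IsBinary (T : OTree Λ) : Prop := T.toForest.IsBinary

end OTree

/-! ## Gaps, edit operations and edit scripts -/

section Edit

variable {Λ : Type*}

/-- `RemoveUpper F k F'`: removing from the forest `F` some set of `k` nodes that contains, with
each of its nodes, the parent of that node (if there is one), leaves the ordered forest `F'`.
The maximal subtrees that avoid the set survive unchanged and in their order. -/
inductive RemoveUpper : OForest Λ → ℕ → OForest Λ → Prop
  | nil : RemoveUpper OForest.nil 0 OForest.nil
  | keep {x : Λ} {c r r' : OForest Λ} {k : ℕ} :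
      RemoveUpper r k r' → RemoveUpper (OForest.cons x c r) k (OForest.cons x c r')
  | remove {x : Λ} {c c' r r' : OForest Λ} {k l : ℕ} :
      RemoveUpper c k c' → RemoveUpper r l r' →
        RemoveUpper (OForest.cons x c r) (k + l + 1) (c'.append r')

/-- `DeleteGap F k F'`: deleting one gap with `k` nodes turns `F` into `F'`. A gap is a non-empty
connected set of nodes: it has a top node, and below that node it contains a set of nodes closed
under taking parents. The subtrees hanging from the gap become, in order and in the place of the
top node, children of the parent of the top node (roots of the forest, if it was a root). -/
inductive DeleteGap : OForest Λ → ℕ → OForest Λ → Prop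
  | top {x : Λ} {c c' r : OForest Λ} {k : ℕ} :
      RemoveUpper c k c' → DeleteGap (OForest.cons x c r) (k + 1) (c'.append r)
  | inside {x : Λ} {c c' r : OForest Λ} {k : ℕ} :
      DeleteGap c k c' → DeleteGap (OForest.cons x c r) k (OForest.cons x c' r)
  | after {x : Λ} {c r r' : OForest Λ} {k : ℕ} :
      DeleteGap r k r' → DeleteGap (OForest.cons x c r) k (OForest.cons x c r')

/-- `Relabel F x y F'`: changing the label of one node from `x` to `y` turns `F` into `F'`. -/
inductive Relabel : OForest Λ → Λ → Λ → OForest Λ → Prop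
  | top {x y : Λ} {c r : OForest Λ} :
      Relabel (OForest.cons x c r) x y (OForest.cons y c r)
  | inside {x y z : Λ} {c c' r : OForest Λ} :
      Relabel c x y c' → Relabel (OForest.cons z c r) x y (OForest.cons z c' r)
  | after {x y z : Λ} {c r r' : OForest Λ} :
      Relabel r x y r' → Relabel (OForest.cons z c r) x y (OForest.cons z c r')

/-- The affine gap cost. -/
noncomputable def gapCost (a b : ℝ) (k : ℕ) : ℝ := if k = 0 then 0 else a + b * k

variable [MetricSpace Λ]

/-- One edit operation together with its cost; relabeling is charged by the metric on labels. -/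
inductive EditStep (a b : ℝ) : OForest Λ → OForest Λ → ℝ → Prop
  | relabel {F G : OForest Λ} {x y : Λ} : Relabel F x y G → EditStep a b F G (dist x y)
  | delete {F G : OForest Λ} {k : ℕ} : DeleteGap F k G → EditStep a b F G (gapCost a b k)
  | insert {F G : OForest Λ} {k : ℕ} : DeleteGap G k F → EditStep a b F G (gapCost a b k)

/-- `EditScript a b F G c`: some finite sequence of edit operations of total cost `c` transforms
`F` into `G`. -/
inductive EditScript (a b : ℝ) : OForest Λ → OForest Λ → ℝ → Prop
  | nil {F : OForest Λ} : EditScript a b F F 0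
  | cons {F G H : OForest Λ} {c d : ℝ} :
      EditStep a b F G c → EditScript a b G H d → EditScript a b F H (c + d)

/-- `d` is the general gap edit distance between `T₁` and `T₂`: the minimum of the costs of all
edit scripts taking `T₁` to `T₂`. -/
def IsGapEditDistance (a b : ℝ) (T₁ T₂ : OTree Λ) (d : ℝ) : Prop :=
  IsLeast {c : ℝ | EditScript a b T₁.toForest T₂.toForest c} d

end Edit

/-! ## A random access machine with real registers

Programs work on natural numbers (indices) and on real numbers (costs), which are kept in scalar
variables and in arrays with computed indices. Natural numbers are only added, subtracted and
compared; real numbers are only copied, added and compared. Every constant, variable access, array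
access, arithmetic operation, comparison and assignment takes one unit of time. -/

namespace RAM

/-- Memory contents: scalar variables and arrays, each with names in `ℕ`. -/
structure State where
  nvar : ℕ → ℕ
  narr : ℕ → ℕ → ℕ
  rvar : ℕ → ℝ
  rarr : ℕ → ℕ → ℝ

/-- Expressions with values in the natural numbers (`sub` is truncated at `0`). -/
inductive NExpr where
  | const (k : ℕ)
  | var (x : ℕ)
  | arr (A : ℕ) (i : NExpr)
  | add (e f : NExpr)
  | sub (e f : NExpr)

def NExpr.eval (s : State) : NExpr → ℕ
  | const k => k
  | var x => s.nvar x
  | arr A i => s.narr A (i.eval s)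
  | add e f => e.eval s + f.eval s
  | sub e f => e.eval s - f.eval s

def NExpr.time : NExpr → ℕ
  | const _ => 1
  | var _ => 1
  | arr _ i => i.time + 1
  | add e f => e.time + f.time + 1
  | sub e f => e.time + f.time + 1

/-- Expressions with values in the real numbers. -/
inductive RExpr where
  | zero
  | var (x : ℕ)
  | arr (A : ℕ) (i : NExpr)
  | add (e f : RExpr)

noncomputable def RExpr.eval (s : State) : RExpr → ℝ
  | zero => 0
  | var x => s.rvar x
  | arr A i => s.rarr A (i.eval s)
  | add e f => e.eval s + f.eval s

def RExpr.time : RExpr → ℕ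
  | zero => 1
  | var _ => 1
  | arr _ i => i.time + 1
  | add e f => e.time + f.time + 1

/-- Tests. -/
inductive Test where
  | nlt (e f : NExpr)
  | neq (e f : NExpr)
  | rlt (e f : RExpr)

/-- The tests hold if, respectively, `e < f`, `e = f` and `e < f`. -/
def Test.Holds (s : State) : Test → Prop
  | nlt e f => e.eval s < f.eval s
  | neq e f => e.eval s = f.eval s
  | rlt e f => e.eval s < f.eval s

def Test.time : Test → ℕ
  | nlt e f => e.time + f.time + 1
  | neq e f => e.time + f.time + 1
  | rlt e f => e.time + f.time + 1

/-- Programs. -/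
inductive Program where
  | skip
  | nset (x : ℕ) (e : NExpr)
  | nstore (A : ℕ) (i e : NExpr)
  | rset (x : ℕ) (e : RExpr)
  | rstore (A : ℕ) (i : NExpr) (e : RExpr)
  | seq (p q : Program)
  | ite (c : Test) (p q : Program)
  | while (c : Test) (p : Program)

/-- `Run p s t s'`: started in the state `s`, the program `p` halts after `t` units of time in the
state `s'`. -/
inductive Run : Program → State → ℕ → State → Prop
  | skip {s : State} : Run Program.skip s 1 s
  | nset {s : State} {x : ℕ} {e : NExpr} :
      Run (Program.nset x e) s (e.time + 1)
        { s with nvar := Function.update s.nvar x (e.eval s) }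
  | nstore {s : State} {A : ℕ} {i e : NExpr} :
      Run (Program.nstore A i e) s (i.time + e.time + 1)
        { s with
          narr := Function.update s.narr A (Function.update (s.narr A) (i.eval s) (e.eval s)) }
  | rset {s : State} {x : ℕ} {e : RExpr} :
      Run (Program.rset x e) s (e.time + 1)
        { s with rvar := Function.update s.rvar x (e.eval s) }
  | rstore {s : State} {A : ℕ} {i : NExpr} {e : RExpr} :
      Run (Program.rstore A i e) s (i.time + e.time + 1)
        { s with
          rarr := Function.update s.rarr A (Function.update (s.rarr A) (i.eval s) (e.eval s)) }
  | seq {p q : Program} {s s' s'' : State} {t t' : ℕ} :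
      Run p s t s' → Run q s' t' s'' → Run (Program.seq p q) s (t + t') s''
  | ite_true {c : Test} {p q : Program} {s s' : State} {t : ℕ} :
      c.Holds s → Run p s t s' → Run (Program.ite c p q) s (c.time + t) s'
  | ite_false {c : Test} {p q : Program} {s s' : State} {t : ℕ} :
      ¬ c.Holds s → Run q s t s' → Run (Program.ite c p q) s (c.time + t) s'
  | while_true {c : Test} {p : Program} {s s' s'' : State} {t t' : ℕ} :
      c.Holds s → Run p s t s' → Run (Program.while c p) s' t' s'' →
        Run (Program.while c p) s (c.time + t + t') s''
  | while_false {c : Test} {p : Program} {s : State} :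
      ¬ c.Holds s → Run (Program.while c p) s c.time s

end RAM

/-- The memory holding the input: the numbers of nodes in the natural-number variables `0` and `1`;
for each tree the numbers of children of its nodes in preorder, in the natural-number arrays `0` and
`1` (this list determines the shape of the tree); `a` and `b` in the real variables `0` and `1`; and
in the real array `0`, row by row, the relabeling costs of all pairs of a node of the first and a
node of the second tree, both taken in preorder. Everything else is `0`. -/
noncomputable def gapInput {Λ : Type*} [MetricSpace Λ] (a b : ℝ) (T₁ T₂ : OTree Λ) : RAM.State where
  nvar x := if x = 0 then T₁.size else if x = 1 then T₂.size else 0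
  narr A i :=
    if A = 0 then T₁.toForest.preorderDegrees.getD i 0
    else if A = 1 then T₂.toForest.preorderDegrees.getD i 0
    else 0
  rvar x := if x = 0 then a else if x = 1 then b else 0
  rarr A i :=
    if A = 0 then
      (T₁.toForest.preorderLabels.flatMap fun x =>
        T₂.toForest.preorderLabels.map fun y => dist x y).getD i 0
    else 0

/-! ## Forests and edit scripts in context -/

namespace OForest

variable {Λ : Type*}

/-! Deletions can be priced locally: each deleted node costs `b`, and `a` more if its parent
survives. Gap costs being affine, this is the total cost of the connected components of the deleted
set, so `Prune` never has to name the gaps. A mapping deletes nodes on both sides until the two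
forests have the same shape, and then pays for the label differences. The gap edit distance is the
least mapping cost.

Every mapping is a script (`IsMappingCost.exists_script`). Conversely, a script is absorbed into a
mapping step by step from its end (`EditStep.exists_mapping`). Relabelings are absorbed by the
triangle inequality, deletions because pruning in two rounds is never cheaper than pruning at once
(`Prune.trans`). The hard case is an inserted gap followed by a pruning (`Prune.commute_deleteGap`).
If the gap and the pruned set are disjoint, the two commute. If they meet, dropping the common nodes
may break the rest of either set into pieces. Deleting the nearest surviving ancestor of the gap on
both sides joins the pieces again, and the `2 * b` saved on a common node pays for it. Above the
roots no such ancestor exists; a flag then declares the parents of the roots deleted, and a credit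
of `2 * a + 2 * b` is kept. For two trees this credit suffices to lower the flag again.

The least mapping cost obeys a recursion on first nodes in preorder (`mappingDist`): delete one of
the two first nodes, or match them and split off the forests below them. The roots with deleted
parents always come first, so a counter records them. On each side only remainders of contexts
occur, and context and position determine the counter as well: after a matched subtree the state is
the same as if its nodes had been deleted one by one (`advance_iterate_size`). A pair of contexts
and a pair of positions thus index a table with `O(m ^ 2 * n ^ 2)` entries. By `contextTable_eq_min`
each takes constant time if contexts and positions decrease, which gives a bound stronger than both
required ones. -/

@[simp] theorem nil_append (F : OForest Λ) : nil.append F = F := rfl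

@[simp] theorem cons_append (x : Λ) (c r F : OForest Λ) :
    (cons x c r).append F = cons x c (r.append F) := rfl

@[simp] theorem append_nil (F : OForest Λ) : F.append nil = F := by
  induction F with
  | nil => rfl
  | cons x c r _ ih => simp [ih]

theorem append_assoc (F G H : OForest Λ) :
    (F.append G).append H = F.append (G.append H) := by
  induction F with
  | nil => rfl
  | cons x c r _ ih => simp [ih]

@[simp] theorem size_append (F G : OForest Λ) : (F.append G).size = F.size + G.size := by
  induction F with
  | nil => simp [size]
  | cons x c r _ ih => simp [size, ih]; omega

@[simp] theorem numRoots_append (F G : OForest Λ) :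
    (F.append G).numRoots = F.numRoots + G.numRoots := by
  induction F with
  | nil => simp [numRoots]
  | cons x c r _ ih => simp [numRoots, ih]; omega

end OForest

theorem RemoveUpper.refl {Λ : Type*} (F : OForest Λ) : RemoveUpper F 0 F := by
  induction F with
  | nil => exact .nil
  | cons x c r _ ih => exact .keep ih

theorem RemoveUpper.append {Λ : Type*} {F F' G G' : OForest Λ} {k l : ℕ}
    (h : RemoveUpper F k F') (h' : RemoveUpper G l G') :
    RemoveUpper (F.append G) (k + l) (F'.append G') := by
  induction h with
  | nil => simpa using h'
  | keep _ ih => exact .keep ih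
  | @remove x c c' r r' k k' hc _ _ ih =>
    rw [OForest.append_assoc, show k + k' + 1 + l = k + (k' + l) + 1 by omega]
    exact .remove hc ih

theorem DeleteGap.append_right {Λ : Type*} {F F' : OForest Λ} {k : ℕ} (G : OForest Λ)
    (h : DeleteGap F k F') : DeleteGap (F.append G) k (F'.append G) := by
  induction h with
  | top hc => rw [OForest.append_assoc]; exact .top hc
  | inside hc _ => exact .inside hc
  | after _ ih => exact .after ih

theorem DeleteGap.append_left {Λ : Type*} {F F' : OForest Λ} {k : ℕ} (G : OForest Λ)
    (h : DeleteGap F k F') : DeleteGap (G.append F) k (G.append F') := by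
  induction G with
  | nil => exact h
  | cons x c r _ ih => exact .after ih

theorem DeleteGap.pos {Λ : Type*} {F F' : OForest Λ} {k : ℕ} (h : DeleteGap F k F') : 0 < k := by
  induction h with
  | top _ => omega
  | inside _ ih => exact ih
  | after _ ih => exact ih

theorem gapCost_of_pos (a b : ℝ) {k : ℕ} (hk : 0 < k) : gapCost a b k = a + b * k :=
  if_neg hk.ne'

theorem Relabel.symm {Λ : Type*} {F G : OForest Λ} {x y : Λ} (h : Relabel F x y G) :
    Relabel G y x F := by
  induction h with
  | top => exact .top
  | inside _ ih => exact .inside ih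
  | after _ ih => exact .after ih

theorem Relabel.append_right {Λ : Type*} {F F' : OForest Λ} {x y : Λ} (G : OForest Λ)
    (h : Relabel F x y F') : Relabel (F.append G) x y (F'.append G) := by
  induction h with
  | top => exact .top
  | inside hc _ => exact .inside hc
  | after _ ih => exact .after ih

theorem Relabel.append_left {Λ : Type*} {F F' : OForest Λ} {x y : Λ} (G : OForest Λ)
    (h : Relabel F x y F') : Relabel (G.append F) x y (G.append F') := by
  induction G with
  | nil => exact h
  | cons z c r _ ih => exact .after ih

section Scripts

variable {Λ : Type*} [MetricSpace Λ] {a b : ℝ}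

theorem EditStep.symm {F G : OForest Λ} {c : ℝ} (h : EditStep a b F G c) :
    EditStep a b G F c := by
  cases h with
  | relabel h => rw [dist_comm]; exact .relabel h.symm
  | delete h => exact .insert h
  | insert h => exact .delete h

namespace EditScript

theorem single {F G : OForest Λ} {c : ℝ} (h : EditStep a b F G c) : EditScript a b F G c := by
  simpa using EditScript.cons h .nil

theorem trans {F G H : OForest Λ} {c d : ℝ} (h : EditScript a b F G c)
    (h' : EditScript a b G H d) : EditScript a b F H (c + d) := by
  induction h with
  | nil => simpa using h'
  | cons hs _ ih => rw [add_assoc]; exact .cons hs (ih h')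

theorem symm {F G : OForest Λ} {c : ℝ} (h : EditScript a b F G c) : EditScript a b G F c := by
  induction h with
  | nil => exact .nil
  | cons hs _ ih => rw [add_comm]; exact ih.trans (single hs.symm)

theorem map (φ : OForest Λ → OForest Λ)
    (hd : ∀ {F G k}, DeleteGap F k G → DeleteGap (φ F) k (φ G))
    (hr : ∀ {F G x y}, Relabel F x y G → Relabel (φ F) x y (φ G))
    {F G : OForest Λ} {c : ℝ} (h : EditScript a b F G c) : EditScript a b (φ F) (φ G) c := by
  induction h with
  | nil => exact .nil
  | cons hs _ ih =>
    refine .cons ?_ ih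
    cases hs with
    | relabel h => exact .relabel (hr h)
    | delete h => exact .delete (hd h)
    | insert h => exact .insert (hd h)

theorem append {F F' G G' : OForest Λ} {c d : ℝ} (h : EditScript a b F F' c)
    (h' : EditScript a b G G' d) : EditScript a b (F.append G) (F'.append G') (c + d) :=
  (h.map (·.append G) (·.append_right G) (·.append_right G)).trans
    (h'.map (F'.append ·) (·.append_left F') (·.append_left F'))

theorem consCongr (x : Λ) {c c' r r' : OForest Λ} {s t : ℝ} (h : EditScript a b c c' s)
    (h' : EditScript a b r r' t) :
    EditScript a b (OForest.cons x c r) (OForest.cons x c' r') (s + t) :=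
  (h.map (OForest.cons x · r) .inside .inside).trans
    (h'.map (OForest.cons x c' ·) .after .after)

end EditScript

end Scripts

/-! ## Mappings -/

/-- `Prune a b f F S t`: deleting some set of nodes of `F` leaves `S`. The cost `t` charges `b` for
each deleted node, and in addition `a` if its parent is not deleted; the parents of the roots of `F`
are regarded as deleted exactly if `f` is true. -/
inductive Prune {Λ : Type*} (a b : ℝ) : Bool → OForest Λ → OForest Λ → ℝ → Prop
  | nil {f : Bool} : Prune a b f OForest.nil OForest.nil 0
  | keep {f : Bool} {x : Λ} {c c' r r' : OForest Λ} {s t : ℝ} :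
      Prune a b false c c' s → Prune a b f r r' t →
        Prune a b f (OForest.cons x c r) (OForest.cons x c' r') (s + t)
  | remove {f : Bool} {x : Λ} {c c' r r' : OForest Λ} {s t : ℝ} :
      Prune a b true c c' s → Prune a b f r r' t →
        Prune a b f (OForest.cons x c r) (c'.append r') (b + (if f then 0 else a) + s + t)

/-- `F` and `G` have the same shape, and `u` is the sum of the distances of corresponding labels. -/
inductive SameShape {Λ : Type*} [MetricSpace Λ] : OForest Λ → OForest Λ → ℝ → Prop
  | nil : SameShape OForest.nil OForest.nil 0
  | cons {x y : Λ} {c c' r r' : OForest Λ} {s t : ℝ} :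
      SameShape c c' s → SameShape r r' t →
        SameShape (OForest.cons x c r) (OForest.cons y c' r') (dist x y + s + t)

/-! ### Composing prunings and commuting them with gap deletions -/

namespace Prune

variable {Λ : Type*} {a b : ℝ}

theorem refl (f : Bool) (F : OForest Λ) : Prune a b f F F 0 := by
  induction F generalizing f with
  | nil => exact .nil
  | cons x c r ihc ihr => simpa using Prune.keep (x := x) (ihc false) (ihr f)

/-- Raising the flag only waives opening charges of deleted roots. -/
theorem mono (ha : 0 ≤ a) {f : Bool} {F S : OForest Λ} {t : ℝ} (h : Prune a b f F S t)
    (g : Bool) : ∃ u ≤ t, Prune a b (f || g) F S u := by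
  induction h with
  | nil => exact ⟨0, le_rfl, .nil⟩
  | keep hc _ _ ihr =>
    obtain ⟨u, hu, h⟩ := ihr
    exact ⟨_, by linarith, .keep hc h⟩
  | @remove f x c c' r r' s t hc _ _ ihr =>
    obtain ⟨u, hu, h⟩ := ihr
    refine ⟨_, ?_, .remove hc h⟩
    cases f <;> cases g <;> simp <;> linarith

theorem toTrue (ha : 0 ≤ a) {f : Bool} {F S : OForest Λ} {t : ℝ} (h : Prune a b f F S t) :
    ∃ u ≤ t, Prune a b true F S u := by
  simpa using h.mono ha true

theorem append {f : Bool} {F S G R : OForest Λ} {s t : ℝ} (h : Prune a b f F S s)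
    (h' : Prune a b f G R t) : Prune a b f (F.append G) (S.append R) (s + t) := by
  induction h with
  | nil => simpa using h'
  | keep hc _ _ ih => rw [add_assoc]; exact .keep hc (ih h')
  | remove hc _ _ ih => rw [add_assoc, OForest.append_assoc]; exact .remove hc (ih h')

theorem of_append {f : Bool} {F G K : OForest Λ} {t : ℝ} (h : Prune a b f (F.append G) K t) :
    ∃ K₁ K₂ t₁ t₂, Prune a b f F K₁ t₁ ∧ Prune a b f G K₂ t₂ ∧ K = K₁.append K₂ ∧
      t = t₁ + t₂ := by
  induction F generalizing K t with
  | nil => exact ⟨_, K, 0, t, .nil, h, rfl, by simp⟩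
  | cons x c r _ ih =>
    cases h with
    | keep hc hr =>
      obtain ⟨K₁, K₂, t₁, t₂, h₁, h₂, rfl, rfl⟩ := ih hr
      exact ⟨_, _, _, _, .keep hc h₁, h₂, rfl, by ring⟩
    | remove hc hr =>
      obtain ⟨K₁, K₂, t₁, t₂, h₁, h₂, rfl, rfl⟩ := ih hr
      exact ⟨_, _, _, _, .remove hc h₁, h₂, by rw [OForest.append_assoc], by ring⟩

/-- Merging two rounds creates no opening charge: a node deleted late keeps its parent unless that
parent was deleted earlier, in which case the node becomes free, and a node deleted early can only
gain a deleted parent. -/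
theorem trans (ha : 0 ≤ a) {f g : Bool} {F S K : OForest Λ} {s t : ℝ} (h : Prune a b f F S s)
    (h' : Prune a b g S K t) : ∃ u ≤ s + t, Prune a b (f || g) F K u := by
  induction h generalizing g K t with
  | nil =>
    cases h'
    exact ⟨0, by simp, .nil⟩
  | @keep f x c c' r r' s₁ s₂ _ _ ihc ihr =>
    cases h' with
    | keep hc hr =>
      obtain ⟨u, hu, h₁⟩ := ihc hc
      obtain ⟨v, hv, h₂⟩ := ihr hr
      exact ⟨_, by linarith, .keep h₁ h₂⟩
    | remove hc hr =>
      obtain ⟨u, hu, h₁⟩ := ihc hc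
      obtain ⟨v, hv, h₂⟩ := ihr hr
      refine ⟨_, ?_, .remove h₁ h₂⟩
      cases f <;> cases g <;> simp <;> linarith
  | @remove f x c c' r r' s₁ s₂ _ _ ihc ihr =>
    obtain ⟨K₁, K₂, t₁, t₂, hc, hr, rfl, rfl⟩ := of_append h'
    obtain ⟨u, hu, h₁⟩ := ihc hc
    obtain ⟨v, hv, h₂⟩ := ihr hr
    refine ⟨_, ?_, .remove h₁ h₂⟩
    cases f <;> cases g <;> simp <;> linarith

theorem of_removeUpper {F S : OForest Λ} {k : ℕ} (h : RemoveUpper F k S) :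
    Prune a b true F S (b * k) := by
  induction h with
  | nil => simpa using Prune.nil
  | @keep x c r r' k _ ih => simpa using Prune.keep (x := x) (refl false c) ih
  | remove _ _ ihc ihr =>
    convert Prune.remove ihc ihr using 1
    push_cast
    simp
    ring

theorem of_deleteGap {F S : OForest Λ} {k : ℕ} (h : DeleteGap F k S) :
    Prune a b false F S (a + b * k) := by
  induction h with
  | @top x c c' r k hc =>
    convert Prune.remove (of_removeUpper hc) (refl false r) using 1
    push_cast
    simp
    ring
  | @inside x c c' r k _ ih => simpa using Prune.keep (x := x) ih (refl false r)
  | @after x c r r' k _ ih => simpa using Prune.keep (x := x) (refl false c) ih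

/-- Pruning is a sequence of gap deletions; if the parents of the roots are deleted, then the gap
that contains them is continued by an upper set. -/
theorem exists_script [MetricSpace Λ] {f : Bool} {F S : OForest Λ} {t : ℝ}
    (h : Prune a b f F S t) :
    if f then ∃ k F₀ s, RemoveUpper F k F₀ ∧ EditScript a b F₀ S s ∧ t = b * k + s
    else EditScript a b F S t := by
  induction h with
  | @nil f =>
    cases f
    · exact .nil
    · exact ⟨0, _, 0, .nil, .nil, by simp⟩
  | @keep f x c c' r r' s t _ _ ihc ihr =>
    cases f
    · exact .consCongr x ihc ihr
    · obtain ⟨k, r₀, u, h₁, h₂, rfl⟩ := ihr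
      exact ⟨k, _, _, .keep h₁, .consCongr x ihc h₂, by ring⟩
  | @remove f x c c' r r' s t _ _ ihc ihr =>
    obtain ⟨k, c₀, u, h₁, h₂, rfl⟩ := ihc
    cases f
    -- The parent of `x` survives, so `x` opens a gap; the upper set removed below `x` belongs to
    -- it.
    · have h₃ := (EditScript.single (.delete (a := a) (b := b) (.top (x := x) (r := r) h₁))).trans
        (h₂.append ihr)
      rw [gapCost_of_pos a b (by omega : 0 < k + 1)] at h₃
      rw [show a + b * ((k + 1 : ℕ) : ℝ) + (u + t) = b + a + (b * k + u) + t by push_cast; ring]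
        at h₃
      exact h₃
    · obtain ⟨l, r₀, v, h₃, h₄, rfl⟩ := ihr
      refine ⟨_, _, _, .remove h₁ h₃, h₂.append h₄, ?_⟩
      push_cast
      simp
      ring

/-- Commuting the removal of an upper set with a pruning: either the upper set avoids all pruned
nodes, or the parents of the roots are best regarded as deleted. -/
theorem commute_removeUpper (ha : 0 ≤ a) (hb : 0 < b) {f : Bool} {F F' S : OForest Λ} {k : ℕ}
    {t : ℝ} (hF : RemoveUpper F k F') (h : Prune a b f F S t) :
    ∃ J r u, RemoveUpper S r J ∧
      ((r = k ∧ Prune a b f F' J u ∧ u ≤ t) ∨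
        (Prune a b true F' J u ∧ u + b * r + 2 * b + (if f then 0 else a) ≤ t + b * k)) := by
  induction hF generalizing f S t with
  | nil =>
    cases h
    exact ⟨_, 0, 0, .nil, .inl ⟨rfl, .nil, le_rfl⟩⟩
  | keep _ ih =>
    cases h with
    | keep hc hr =>
      obtain ⟨J, r, u, h₁, ⟨hk, h₂, h₃⟩ | ⟨h₂, h₃⟩⟩ := ih hr
      · exact ⟨_, r, _, .keep h₁, .inl ⟨hk, .keep hc h₂, by linarith⟩⟩
      · exact ⟨_, r, _, .keep h₁, .inr ⟨.keep hc h₂, by linarith⟩⟩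
    | @remove _ _ _ c' _ r' _ _ hc hr =>
      obtain ⟨J, r, u, h₁, h₂⟩ := ih hr
      have h₀ := (RemoveUpper.refl c').append h₁
      rw [zero_add] at h₀
      obtain ⟨hk, h₂, h₃⟩ | ⟨h₂, h₃⟩ := h₂
      · exact ⟨_, r, _, h₀, .inl ⟨hk, .remove hc h₂, by linarith⟩⟩
      · refine ⟨_, r, _, h₀, .inr ⟨.remove hc h₂, ?_⟩⟩
        cases f <;> simp at h₃ ⊢ <;> linarith
  | @remove x c₀ c₁ r₀ r₁ k l _ _ ihc ihr =>
    cases h with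
    | keep hc hr =>
      obtain ⟨J, i, u, h₁, h₂⟩ := ihc hc
      obtain ⟨J', i', u', h₁', h₂'⟩ := ihr hr
      have h₀ := RemoveUpper.remove (x := x) h₁ h₁'
      obtain ⟨rfl, h₂, h₃⟩ | ⟨h₂, h₃⟩ := h₂ <;> obtain ⟨rfl, h₂', h₃'⟩ | ⟨h₂', h₃'⟩ := h₂'
      · obtain ⟨v, hv, h₂⟩ := h₂.mono ha f
        exact ⟨_, _, _, h₀, .inl ⟨rfl, h₂.append h₂', by linarith⟩⟩
      -- As soon as one part meets a pruned node, the flag is raised for both; by `toTrue` this does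
      -- not increase the cost of the other.
      all_goals
        obtain ⟨v, hv, h₂⟩ := h₂.toTrue ha
        obtain ⟨v', hv', h₂'⟩ := h₂'.toTrue ha
        refine ⟨_, _, _, h₀, .inr ⟨h₂.append h₂', ?_⟩⟩
        push_cast
        cases f <;> simp only [Bool.false_eq_true, ↓reduceIte] at * <;> linarith
    | remove hc hr =>
      obtain ⟨J, i, u, h₁, h₂⟩ := ihc hc
      obtain ⟨J', i', u', h₁', h₂'⟩ := ihr hr
      have h₀ := h₁.append h₁'
      obtain ⟨rfl, h₂, h₃⟩ | ⟨h₂, h₃⟩ := h₂ <;> obtain ⟨rfl, h₂', h₃'⟩ | ⟨h₂', h₃'⟩ := h₂'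
      -- Here `x` lies in both sets. Its `b` was paid in `t` and again in `b * k`, its opening
      -- charge in `t`, and none of these is needed any more: this is the surplus on the left.
      all_goals
        obtain ⟨v', hv', h₂'⟩ := h₂'.toTrue ha
        refine ⟨_, _, _, h₀, .inr ⟨h₂.append h₂', ?_⟩⟩
        push_cast
        cases f <;> simp only [Bool.false_eq_true, ↓reduceIte] at * <;> linarith

/-- Commuting the deletion of a gap with a pruning. -/
theorem commute_deleteGap (ha : 0 ≤ a) (hb : 0 < b) {f : Bool} {G F S : OForest Λ} {k : ℕ}
    {t : ℝ} (hG : DeleteGap G k F) (h : Prune a b f G S t) :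
    (∃ J u v, Prune a b f F J u ∧
        ((S = J ∧ v = 0) ∨ ∃ r, DeleteGap S r J ∧ v = a + b * r) ∧ u + v ≤ t + (a + b * k)) ∨
      ∃ J r u, Prune a b true F J u ∧ RemoveUpper S r J ∧
        u + b * r + 2 * b + (if f then 0 else a) ≤ t + b * k := by
  induction hG generalizing f S t with
  | @top x c c' r k hc =>
    cases h with
    | keep h hr =>
      obtain ⟨J, i, u, h₁, ⟨rfl, h₂, h₃⟩ | ⟨h₂, h₃⟩⟩ := commute_removeUpper ha hb hc h
      · obtain ⟨v, hv, h₂⟩ := h₂.mono ha f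
        exact .inl ⟨_, _, _, h₂.append hr, .inr ⟨_, .top h₁, rfl⟩, by linarith⟩
      · obtain ⟨v, hv, hr⟩ := hr.toTrue ha
        refine .inr ⟨_, _, _, h₂.append hr, .remove h₁ (.refl _), ?_⟩
        push_cast
        cases f <;> simp only [Bool.false_eq_true, ↓reduceIte] at * <;> linarith
    | remove h hr =>
      obtain ⟨J, i, u, h₁, h₂⟩ := commute_removeUpper ha hb hc h
      obtain ⟨v, hv, hr⟩ := hr.toTrue ha
      obtain ⟨rfl, h₂, h₃⟩ | ⟨h₂, h₃⟩ := h₂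
      all_goals
        refine .inr ⟨_, _, _, h₂.append hr, h₁.append (.refl _), ?_⟩
        push_cast
        cases f <;> simp only [Bool.false_eq_true, ↓reduceIte] at * <;> linarith
  | @inside x c c' r k hc ih =>
    cases h with
    | keep h hr =>
      obtain ⟨J, u, v, h₁, h₂, h₃⟩ | ⟨J, i, u, h₁, h₂, h₃⟩ := ih h
      · refine .inl ⟨_, _, v, .keep h₁ hr, ?_, by linarith⟩
        obtain ⟨rfl, hv⟩ | ⟨i, h₂, hv⟩ := h₂
        · exact .inl ⟨rfl, hv⟩
        · exact .inr ⟨i, .inside h₂, hv⟩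
      -- The kept node `x` is the surviving ancestor: it is now deleted on both sides, which makes
      -- the flag below it true and turns the upper set below it into one gap. The surplus `2 * b +
      -- a` in `h₃` pays for this.
      · refine .inl ⟨_, _, _, .remove h₁ hr, .inr ⟨_, .top h₂, rfl⟩, ?_⟩
        push_cast
        cases f <;> simp only [Bool.false_eq_true, ↓reduceIte] at * <;> linarith
    | remove h hr =>
      obtain ⟨J, u, v, h₁, h₂, h₃⟩ | ⟨J, i, u, h₁, h₂, h₃⟩ := ih h
      · refine .inl ⟨_, _, v, .remove h₁ hr, ?_, by linarith⟩
        obtain ⟨rfl, hv⟩ | ⟨i, h₂, hv⟩ := h₂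
        · exact .inl ⟨rfl, hv⟩
        · exact .inr ⟨i, h₂.append_right _, hv⟩
      · obtain ⟨v, hv, hr⟩ := hr.toTrue ha
        refine .inr ⟨_, _, _, .remove h₁ hr, h₂.append (.refl _), ?_⟩
        push_cast
        cases f <;> simp only [Bool.false_eq_true, ↓reduceIte] at * <;> linarith
  | @after x c r r' k hr ih =>
    cases h with
    | keep hc h =>
      obtain ⟨J, u, v, h₁, h₂, h₃⟩ | ⟨J, i, u, h₁, h₂, h₃⟩ := ih h
      · refine .inl ⟨_, _, v, .keep hc h₁, ?_, by linarith⟩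
        obtain ⟨rfl, hv⟩ | ⟨i, h₂, hv⟩ := h₂
        · exact .inl ⟨rfl, hv⟩
        · exact .inr ⟨i, .after h₂, hv⟩
      · exact .inr ⟨_, _, _, .keep hc h₁, .keep h₂, by linarith⟩
    | @remove _ _ _ c₁ _ _ _ _ hc h =>
      obtain ⟨J, u, v, h₁, h₂, h₃⟩ | ⟨J, i, u, h₁, h₂, h₃⟩ := ih h
      · refine .inl ⟨_, _, v, .remove hc h₁, ?_, by linarith⟩
        obtain ⟨rfl, hv⟩ | ⟨i, h₂, hv⟩ := h₂
        · exact .inl ⟨rfl, hv⟩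
        · exact .inr ⟨i, h₂.append_left _, hv⟩
      · have h₀ := (RemoveUpper.refl c₁).append h₂
        rw [zero_add] at h₀
        refine .inr ⟨_, _, _, .remove hc h₁, h₀, ?_⟩
        cases f <;> simp only [Bool.false_eq_true, ↓reduceIte] at * <;> linarith

end Prune

/-! ### Transporting deletions and relabelings between forests of equal shape -/

namespace SameShape

variable {Λ : Type*} [MetricSpace Λ]

theorem refl (F : OForest Λ) : SameShape F F 0 := by
  induction F with
  | nil => exact .nil
  | cons x c r ihc ihr => simpa using SameShape.cons (x := x) (y := x) ihc ihr

theorem append {F F' G G' : OForest Λ} {s t : ℝ} (h : SameShape F F' s) (h' : SameShape G G' t) :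
    SameShape (F.append G) (F'.append G') (s + t) := by
  induction h with
  | nil => simpa using h'
  | cons hc _ _ ih => rw [add_assoc]; exact .cons hc ih

/-- The corresponding nodes are removed from `L`, and their label distances drop out of the sum. -/
theorem removeUpper {S J L : OForest Λ} {k : ℕ} {u : ℝ} (hS : RemoveUpper S k J)
    (h : SameShape S L u) : ∃ J' v, v ≤ u ∧ RemoveUpper L k J' ∧ SameShape J J' v := by
  induction hS generalizing L u with
  | nil => cases h; exact ⟨_, 0, le_rfl, .nil, .nil⟩
  | keep _ ih =>
    cases h with
    | cons hc hr =>
      obtain ⟨J', v, hv, h₁, h₂⟩ := ih hr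
      exact ⟨_, _, by linarith, .keep h₁, .cons hc h₂⟩
  | @remove x _ _ _ _ _ _ _ _ ihc ihr =>
    cases h with
    | @cons _ y _ _ _ _ _ _ hc hr =>
      obtain ⟨J₁, v₁, hv₁, h₁, h₁'⟩ := ihc hc
      obtain ⟨J₂, v₂, hv₂, h₂, h₂'⟩ := ihr hr
      exact ⟨_, _, by linarith [dist_nonneg (x := x) (y := y)], .remove h₁ h₂, h₁'.append h₂'⟩

theorem deleteGap {S J L : OForest Λ} {k : ℕ} {u : ℝ} (hS : DeleteGap S k J)
    (h : SameShape S L u) : ∃ J' v, v ≤ u ∧ DeleteGap L k J' ∧ SameShape J J' v := by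
  induction hS generalizing L u with
  | @top x _ _ _ _ hc =>
    cases h with
    | @cons _ y _ _ _ _ _ _ h hr =>
      obtain ⟨J', v, hv, h₁, h₂⟩ := removeUpper hc h
      exact ⟨_, _, by linarith [dist_nonneg (x := x) (y := y)], .top h₁, h₂.append hr⟩
  | inside _ ih =>
    cases h with
    | cons hc hr =>
      obtain ⟨J', v, hv, h₁, h₂⟩ := ih hc
      exact ⟨_, _, by linarith, .inside h₁, .cons h₂ hr⟩
  | after _ ih =>
    cases h with
    | cons hc hr =>
      obtain ⟨J', v, hv, h₁, h₂⟩ := ih hr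
      exact ⟨_, _, by linarith, .after h₁, .cons hc h₂⟩

theorem relabel {F G L : OForest Λ} {x y : Λ} {u : ℝ} (hF : Relabel F x y G)
    (h : SameShape G L u) : ∃ v ≤ dist x y + u, SameShape F L v := by
  induction hF generalizing L u with
  | @top x y c r =>
    cases h with
    | @cons _ z _ _ _ _ _ _ hc hr =>
      exact ⟨_, by linarith [dist_triangle x y z], .cons hc hr⟩
  | inside _ ih =>
    cases h with
    | cons hc hr =>
      obtain ⟨v, hv, h⟩ := ih hc
      exact ⟨_, by linarith, .cons h hr⟩
  | after _ ih =>
    cases h with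
    | cons hc hr =>
      obtain ⟨v, hv, h⟩ := ih hr
      exact ⟨_, by linarith, .cons hc h⟩

theorem exists_script {a b : ℝ} {F G : OForest Λ} {u : ℝ} (h : SameShape F G u) :
    EditScript a b F G u := by
  induction h with
  | nil => exact .nil
  | @cons x y c c' r r' s t _ _ ihc ihr =>
    rw [add_assoc]
    exact .cons (.relabel .top) (ihc.consCongr y ihr)

end SameShape

/-- Pruning costs ignore labels, so the relabeling can be postponed; it disappears if its node is
pruned. -/
theorem Prune.relabel {Λ : Type*} {a b : ℝ} {f : Bool} {F G S : OForest Λ} {x y : Λ} {t : ℝ}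
    (hF : Relabel F x y G) (h : Prune a b f G S t) :
    ∃ S', Prune a b f F S' t ∧ (S' = S ∨ Relabel S' x y S) := by
  induction hF generalizing f S t with
  | top =>
    cases h with
    | keep hc hr => exact ⟨_, .keep hc hr, .inr .top⟩
    | remove hc hr => exact ⟨_, .remove hc hr, .inl rfl⟩
  | inside _ ih =>
    cases h with
    | keep hc hr =>
      obtain ⟨S', h₁, rfl | h₂⟩ := ih hc
      · exact ⟨_, .keep h₁ hr, .inl rfl⟩
      · exact ⟨_, .keep h₁ hr, .inr (.inside h₂)⟩
    | remove hc hr =>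
      obtain ⟨S', h₁, rfl | h₂⟩ := ih hc
      · exact ⟨_, .remove h₁ hr, .inl rfl⟩
      · exact ⟨_, .remove h₁ hr, .inr (h₂.append_right _)⟩
  | after _ ih =>
    cases h with
    | keep hc hr =>
      obtain ⟨S', h₁, rfl | h₂⟩ := ih hr
      · exact ⟨_, .keep hc h₁, .inl rfl⟩
      · exact ⟨_, .keep hc h₁, .inr (.after h₂)⟩
    | remove hc hr =>
      obtain ⟨S', h₁, rfl | h₂⟩ := ih hr
      · exact ⟨_, .remove hc h₁, .inl rfl⟩
      · exact ⟨_, .remove hc h₁, .inr (h₂.append_left _)⟩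

/-- Only deleted roots are affected by the flag, and a tree has a single one, so at most one opening
charge is added. -/
theorem Prune.tree_toFalse {Λ : Type*} {a b : ℝ} (ha : 0 ≤ a) {T : OTree Λ} {S : OForest Λ} {t : ℝ}
    (h : Prune a b true T.toForest S t) : ∃ u ≤ t + a, Prune a b false T.toForest S u := by
  unfold OTree.toForest at *
  cases h with
  | keep hc hr => cases hr; exact ⟨_, by linarith, .keep hc .nil⟩
  | remove hc hr => cases hr; exact ⟨_, by simp; linarith, .remove hc .nil⟩

/-- There is a mapping between `F` and `G` of cost `c`: after deleting the unmapped nodes on both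
sides, the forests have the same shape. -/
def IsMappingCost {Λ : Type*} [MetricSpace Λ] (a b : ℝ) (f : Bool) (F G : OForest Λ) (c : ℝ) :
    Prop :=
  ∃ S L t u q, Prune a b f F S t ∧ SameShape S L u ∧ Prune a b f G L q ∧ c = t + u + q

/-! ### Edit scripts versus mappings -/

section Mappings

variable {Λ : Type*} [MetricSpace Λ] {a b : ℝ}

theorem IsMappingCost.exists_script {F G : OForest Λ} {c : ℝ}
    (h : IsMappingCost a b false F G c) : EditScript a b F G c := by
  obtain ⟨S, L, t, u, q, h₁, h₂, h₃, rfl⟩ := h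
  have h₁' := h₁.exists_script
  have h₃' := h₃.exists_script
  exact (EditScript.trans h₁' h₂.exists_script).trans (EditScript.symm h₃')

/-- An edit step in front of a mapping yields a mapping, which need not cost more than both. If the
parents of the roots have to be regarded as deleted, then this is charged as one gap with one node
in each forest. -/
theorem EditStep.exists_mapping (ha : 0 ≤ a) (hb : 0 < b) {F G H : OForest Λ} {c d : ℝ} {f : Bool}
    (hs : EditStep a b F G c) (h : IsMappingCost a b f G H d) :
    ∃ g e, IsMappingCost a b g F H e ∧
      e + (if g then 2 * a + 2 * b else 0) ≤ c + (d + (if f then 2 * a + 2 * b else 0)) := by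
  obtain ⟨S, L, t, u, q, h₁, h₂, h₃, rfl⟩ := h
  cases hs with
  | @relabel x y hs =>
    obtain ⟨S', h, rfl | h'⟩ := h₁.relabel hs
    · exact ⟨f, _, ⟨_, _, _, _, _, h, h₂, h₃, rfl⟩, by linarith [dist_nonneg (x := x) (y := y)]⟩
    · obtain ⟨v, hv, h'⟩ := h₂.relabel h'
      exact ⟨f, _, ⟨_, _, _, _, _, h, h', h₃, rfl⟩, by linarith⟩
  | delete hs =>
    rw [gapCost_of_pos a b hs.pos]
    obtain ⟨v, hv, h⟩ := (Prune.of_deleteGap (a := a) (b := b) hs).trans ha h₁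
    exact ⟨f, _, ⟨_, _, _, _, _, by simpa using h, h₂, h₃, rfl⟩, by linarith⟩
  | insert hs =>
    rw [gapCost_of_pos a b hs.pos]
    obtain ⟨J, v, w, h, h', hc⟩ | ⟨J, r, v, h, h', hc⟩ := h₁.commute_deleteGap ha hb hs
    · obtain ⟨rfl, rfl⟩ | ⟨r, h', rfl⟩ := h'
      · exact ⟨f, _, ⟨_, _, _, _, _, h, h₂, h₃, rfl⟩, by linarith⟩
      · obtain ⟨J', u', hu', h₄, h₅⟩ := h₂.deleteGap h'
        obtain ⟨q', hq', h₆⟩ := h₃.trans ha (Prune.of_deleteGap h₄)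
        exact ⟨f, _, ⟨_, _, _, _, _, h, h₅, by simpa using h₆, rfl⟩, by linarith⟩
    · obtain ⟨J', u', hu', h₄, h₅⟩ := h₂.removeUpper h'
      obtain ⟨q', hq', h₆⟩ := h₃.trans ha (Prune.of_removeUpper h₄)
      -- If the flag is raised here, the surplus `2 * b + a` from commuting and the opening charge
      -- `a` of the inserted gap form the credit `2 * a + 2 * b`.
      refine ⟨true, _, ⟨_, _, _, _, _, h, h₅, by simpa using h₆, rfl⟩, ?_⟩
      cases f <;> simp only [Bool.false_eq_true, ↓reduceIte] at * <;> linarith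

theorem EditScript.exists_mapping (ha : 0 ≤ a) (hb : 0 < b) {F G : OForest Λ} {c : ℝ}
    (h : EditScript a b F G c) :
    ∃ g e, IsMappingCost a b g F G e ∧ e + (if g then 2 * a + 2 * b else 0) ≤ c := by
  induction h with
  | @nil F => exact ⟨false, 0, ⟨F, F, 0, 0, 0, .refl _ _, .refl _, .refl _ _, by simp⟩, by simp⟩
  | cons hs _ ih =>
    obtain ⟨f, d, h, hd⟩ := ih
    obtain ⟨g, e, h', he⟩ := hs.exists_mapping ha hb h
    exact ⟨g, e, h', by linarith⟩

/-- The credit `2 * a + 2 * b` of a raised flag covers one new opening charge in each tree. -/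
theorem EditScript.exists_mapping_of_trees (ha : 0 ≤ a) (hb : 0 < b) {T₁ T₂ : OTree Λ} {c : ℝ}
    (h : EditScript a b T₁.toForest T₂.toForest c) :
    ∃ e ≤ c, IsMappingCost a b false T₁.toForest T₂.toForest e := by
  obtain ⟨g, e, h, he⟩ := h.exists_mapping ha hb
  cases g
  · exact ⟨e, by simpa using he, h⟩
  · obtain ⟨S, L, t, u, q, h₁, h₂, h₃, rfl⟩ := h
    obtain ⟨t', ht', h₁⟩ := h₁.tree_toFalse ha
    obtain ⟨q', hq', h₃⟩ := h₃.tree_toFalse ha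
    simp only [↓reduceIte] at he
    exact ⟨_, by linarith, _, _, _, _, _, h₁, h₂, h₃, rfl⟩

end Mappings

/-! ## The recursion -/

/-- As `Prune`, where the parents of exactly the first `n` roots are regarded as deleted. -/
inductive PruneFirst {Λ : Type*} (a b : ℝ) : ℕ → OForest Λ → OForest Λ → ℝ → Prop
  | nil {n : ℕ} : PruneFirst a b n OForest.nil OForest.nil 0
  | keep {n : ℕ} {x : Λ} {c c' r r' : OForest Λ} {s t : ℝ} :
      PruneFirst a b 0 c c' s → PruneFirst a b (n - 1) r r' t →
        PruneFirst a b n (OForest.cons x c r) (OForest.cons x c' r') (s + t)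
  | remove {n : ℕ} {x : Λ} {c c' r r' : OForest Λ} {s t : ℝ} :
      PruneFirst a b c.numRoots c c' s → PruneFirst a b (n - 1) r r' t →
        PruneFirst a b n (OForest.cons x c r) (c'.append r')
          (b + (if n = 0 then a else 0) + s + t)

/-- The cheapest mapping cost of two forests, where the parents of the first `n`, respectively `n'`,
roots are regarded as deleted. -/
noncomputable def mappingDist {Λ : Type*} [MetricSpace Λ] (a b : ℝ) :
    ℕ → OForest Λ → ℕ → OForest Λ → ℝ
  | _, .nil, _, .nil => 0
  | n, .cons _ c r, n', .nil =>
    b + (if n = 0 then a else 0) +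
      mappingDist a b (c.numRoots + (n - 1)) (c.append r) n' .nil
  | n, .nil, n', .cons _ c' r' =>
    b + (if n' = 0 then a else 0) +
      mappingDist a b n .nil (c'.numRoots + (n' - 1)) (c'.append r')
  | n, .cons x c r, n', .cons y c' r' =>
    min (min
      (b + (if n = 0 then a else 0) +
        mappingDist a b (c.numRoots + (n - 1)) (c.append r) n' (.cons y c' r'))
      (b + (if n' = 0 then a else 0) +
        mappingDist a b n (.cons x c r) (c'.numRoots + (n' - 1)) (c'.append r')))
      (dist x y + mappingDist a b 0 c 0 c' + mappingDist a b (n - 1) r (n' - 1) r')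
termination_by _ F _ G => F.size + G.size
decreasing_by all_goals simp only [OForest.size, OForest.size_append]; omega

/-! ### Prunings with a counter for deleted parents -/

namespace PruneFirst

variable {Λ : Type*} {a b : ℝ}

/-- By `hn` the counter for `F` is used up exactly at the end of `F`, so that `k` is what is left
for `G`. -/
theorem append {F S G R : OForest Λ} {s t : ℝ} {n k : ℕ} (h : PruneFirst a b n F S s)
    (hn : n = F.numRoots) (h' : PruneFirst a b k G R t) :
    PruneFirst a b (n + k) (F.append G) (S.append R) (s + t) := by
  induction h with
  | nil => simpa [hn, OForest.numRoots] using h'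
  | @keep n x c c' r r' s t hc _ _ ih =>
    simp only [OForest.numRoots] at hn
    rw [add_assoc]
    refine .keep hc ?_
    rw [show n + k - 1 = n - 1 + k by omega]
    exact ih (by omega)
  | @remove n x c c' r r' s t hc _ _ ih =>
    simp only [OForest.numRoots] at hn
    rw [add_assoc, OForest.append_assoc, if_neg (by omega),
      ← if_neg (c := n + k = 0) (t := a) (e := (0 : ℝ)) (by omega)]
    refine .remove hc ?_
    rw [show n + k - 1 = n - 1 + k by omega]
    exact ih (by omega)

theorem of_append {F G K : OForest Λ} {t : ℝ} {k : ℕ}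
    (h : PruneFirst a b (F.numRoots + k) (F.append G) K t) :
    ∃ K₁ K₂ t₁ t₂, PruneFirst a b F.numRoots F K₁ t₁ ∧ PruneFirst a b k G K₂ t₂ ∧
      K = K₁.append K₂ ∧ t = t₁ + t₂ := by
  induction F generalizing K t with
  | nil => exact ⟨_, K, 0, t, .nil, by simpa [OForest.numRoots] using h, rfl, by simp⟩
  | cons x c r _ ih =>
    simp only [OForest.numRoots] at *
    have e : 1 + r.numRoots + k - 1 = r.numRoots + k := by omega
    have e' : 1 + r.numRoots - 1 = r.numRoots := by omega
    cases h with
    | keep hc hr =>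
      rw [e] at hr
      obtain ⟨K₁, K₂, t₁, t₂, h₁, h₂, rfl, rfl⟩ := ih hr
      exact ⟨_, _, _, _, .keep hc (by rwa [e']), h₂, rfl, by ring⟩
    | remove hc hr =>
      rw [e] at hr
      obtain ⟨K₁, K₂, t₁, t₂, h₁, h₂, rfl, rfl⟩ := ih hr
      refine ⟨_, _, _, _, .remove hc (by rwa [e']), h₂, by rw [OForest.append_assoc], ?_⟩
      rw [if_neg (by omega), if_neg (by omega)]
      ring

/-- This is the deletion step of the recursion: children of a deleted root come in front of its
siblings, so the roots with deleted parents stay an initial segment. -/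
theorem head {x : Λ} {c r S : OForest Λ} {n : ℕ} {t : ℝ}
    (h : PruneFirst a b (c.numRoots + (n - 1)) (c.append r) S t) :
    PruneFirst a b n (.cons x c r) S (b + (if n = 0 then a else 0) + t) := by
  obtain ⟨K₁, K₂, t₁, t₂, h₁, h₂, rfl, rfl⟩ := of_append h
  rw [← add_assoc]
  exact .remove h₁ h₂

theorem of_prune {f : Bool} {F S : OForest Λ} {t : ℝ} (h : Prune a b f F S t) :
    PruneFirst a b (if f then F.numRoots else 0) F S t := by
  induction h with
  | nil => exact .nil
  | @keep f x c c' r r' s t _ _ ihc ihr =>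
    refine .keep ihc ?_
    cases f <;> simpa [OForest.numRoots] using ihr
  | @remove f x c c' r r' s t _ _ ihc ihr =>
    have h := PruneFirst.remove (x := x) (n := if f then (OForest.cons x c r).numRoots else 0) ihc
      (r := r) (r' := r') (t := t) (by cases f <;> simpa [OForest.numRoots] using ihr)
    cases f <;> simpa [OForest.numRoots] using h

theorem toPrune {n : ℕ} {F S : OForest Λ} {t : ℝ} (h : PruneFirst a b n F S t) :
    (n = 0 → Prune a b false F S t) ∧ (n = F.numRoots → Prune a b true F S t) := by
  induction h with
  | nil => exact ⟨fun _ => .nil, fun _ => .nil⟩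
  | keep _ _ ihc ihr =>
    simp only [OForest.numRoots]
    exact ⟨fun hn => .keep (ihc.1 rfl) (ihr.1 (by omega)),
      fun hn => .keep (ihc.1 rfl) (ihr.2 (by omega))⟩
  | @remove n x _ _ _ _ _ _ _ _ ihc ihr =>
    simp only [OForest.numRoots]
    constructor
    · intro hn
      simpa [hn] using Prune.remove (ihc.2 rfl) (ihr.1 (by omega))
    · intro hn
      have := Prune.remove (x := x) (ihc.2 rfl) (ihr.2 (by omega))
      rw [if_neg (by omega)]
      simpa using this

end PruneFirst

/-! ### The recursion computes the least mapping cost -/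

section Recursion

variable {Λ : Type*} [MetricSpace Λ] {a b : ℝ}

/-- Induction on the total size along the first nodes. If one of them is deleted, the prunings of
its children and siblings concatenate to one of a smaller forest. If both are kept, equality of
shapes matches them with each other. -/
theorem mappingDist_le {n n' : ℕ} {F G S L : OForest Λ} {t u q : ℝ}
    (h₁ : PruneFirst a b n F S t) (h₂ : SameShape S L u) (h₃ : PruneFirst a b n' G L q) :
    mappingDist a b n F n' G ≤ t + u + q := by
  induction hN : F.size + G.size using Nat.strong_induction_on generalizing n n' F G S L t u q with
  | _ N ih =>
    subst hN
    cases h₁ with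
    | nil =>
      cases h₂
      generalize hL : OForest.nil (Λ := Λ) = L at h₃
      cases h₃ with
      | nil => simp [mappingDist]
      | keep _ _ => cases hL
      | remove hc hr =>
        have := ih _ (by simp [OForest.size]) (.nil (n := n)) .nil (hL ▸ hc.append rfl hr) rfl
        rw [← hL, mappingDist]
        linarith
    | @remove _ x c c' r r' s s' hc hr =>
      have := ih _ (by simp [OForest.size]) (hc.append rfl hr) h₂ h₃ rfl
      cases G with
      | nil => rw [mappingDist]; linarith
      | cons y d e =>
        rw [mappingDist]
        refine (min_le_left _ _).trans ((min_le_left _ _).trans ?_)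
        linarith
    | @keep _ x c c' r r' s s' hc hr =>
      have h₁ := PruneFirst.keep (x := x) hc hr
      generalize hL : L = L' at h₃
      cases h₃ with
      | nil => subst hL; cases h₂
      | @remove _ y d d' e e' v v' hd he =>
        subst hL
        have := ih _ (by simp [OForest.size]) h₁ h₂ (hd.append rfl he) rfl
        rw [mappingDist]
        refine (min_le_left _ _).trans ((min_le_right _ _).trans ?_)
        linarith
      | @keep _ y d d' e e' v v' hd he =>
        subst hL
        cases h₂ with
        | cons hs ht =>
          have i₁ := ih _ (by simp only [OForest.size]; omega) hc hs hd rfl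
          have i₂ := ih _ (by simp only [OForest.size]; omega) hr ht he rfl
          rw [mappingDist]
          refine (min_le_right _ _).trans ?_
          linarith

/-- Each branch of the recursion extends an actual mapping, so the value is attained and not only a
lower bound. -/
theorem exists_mapping_mappingDist (n : ℕ) (F : OForest Λ) (n' : ℕ) (G : OForest Λ) :
    ∃ S L t u q, PruneFirst a b n F S t ∧ SameShape S L u ∧ PruneFirst a b n' G L q ∧
      mappingDist a b n F n' G = t + u + q := by
  induction hN : F.size + G.size using Nat.strong_induction_on generalizing n n' F G with
  | _ N ih =>
    subst hN
    cases F with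
    | nil =>
      cases G with
      | nil => exact ⟨_, _, 0, 0, 0, .nil, .nil, .nil, by simp [mappingDist]⟩
      | cons y d e =>
        obtain ⟨S, L, t, u, q, h₁, h₂, h₃, h⟩ :=
          ih _ (by simp [OForest.size]) n .nil (d.numRoots + (n' - 1)) (d.append e) rfl
        exact ⟨_, _, _, _, _, h₁, h₂, h₃.head, by rw [mappingDist, h]; ring⟩
    | cons x c r =>
      cases G with
      | nil =>
        obtain ⟨S, L, t, u, q, h₁, h₂, h₃, h⟩ :=
          ih _ (by simp [OForest.size]) (c.numRoots + (n - 1)) (c.append r) n' .nil rfl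
        exact ⟨_, _, _, _, _, h₁.head, h₂, h₃, by rw [mappingDist, h]; ring⟩
      | cons y d e =>
        rw [mappingDist]
        rcases min_choice (min
          (b + (if n = 0 then a else 0) +
            mappingDist a b (c.numRoots + (n - 1)) (c.append r) n' (.cons y d e))
          (b + (if n' = 0 then a else 0) +
            mappingDist a b n (.cons x c r) (d.numRoots + (n' - 1)) (d.append e)))
          (dist x y + mappingDist a b 0 c 0 d + mappingDist a b (n - 1) r (n' - 1) e)
          with hm | hm <;> rw [hm]
        · rcases min_choice (b + (if n = 0 then a else 0) +
            mappingDist a b (c.numRoots + (n - 1)) (c.append r) n' (.cons y d e))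
            (b + (if n' = 0 then a else 0) +
            mappingDist a b n (.cons x c r) (d.numRoots + (n' - 1)) (d.append e)) with hm | hm <;>
            rw [hm]
          · obtain ⟨S, L, t, u, q, h₁, h₂, h₃, h⟩ :=
              ih _ (by simp [OForest.size]) (c.numRoots + (n - 1)) (c.append r) n' (.cons y d e) rfl
            exact ⟨_, _, _, _, _, h₁.head, h₂, h₃, by rw [h]; ring⟩
          · obtain ⟨S, L, t, u, q, h₁, h₂, h₃, h⟩ :=
              ih _ (by simp [OForest.size]) n (.cons x c r) (d.numRoots + (n' - 1)) (d.append e) rfl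
            exact ⟨_, _, _, _, _, h₁, h₂, h₃.head, by rw [h]; ring⟩
        · obtain ⟨S, L, t, u, q, h₁, h₂, h₃, h⟩ :=
            ih _ (by simp only [OForest.size]; omega) 0 c 0 d rfl
          obtain ⟨S', L', t', u', q', h₁', h₂', h₃', h'⟩ :=
            ih _ (by simp only [OForest.size]; omega) (n - 1) r (n' - 1) e rfl
          exact ⟨_, _, _, _, _, .keep h₁ h₁', .cons h₂ h₂', .keep h₃ h₃', by rw [h, h']; ring⟩

theorem isGapEditDistance_mappingDist (ha : 0 ≤ a) (hb : 0 < b) (T₁ T₂ : OTree Λ) :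
    IsGapEditDistance a b T₁ T₂ (mappingDist a b 0 T₁.toForest 0 T₂.toForest) := by
  constructor
  · obtain ⟨S, L, t, u, q, h₁, h₂, h₃, h⟩ :=
      exists_mapping_mappingDist (a := a) (b := b) 0 T₁.toForest 0 T₂.toForest
    exact IsMappingCost.exists_script
      ⟨_, _, _, _, _, h₁.toPrune.1 rfl, h₂, h₃.toPrune.1 rfl, h⟩
  · intro c hc
    obtain ⟨e, he, S, L, t, u, q, h₁, h₂, h₃, rfl⟩ :=
      EditScript.exists_mapping_of_trees ha hb hc
    exact (mappingDist_le (by simpa using PruneFirst.of_prune h₁) h₂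
      (by simpa using PruneFirst.of_prune h₃)).trans he

end Recursion

/-! ## Preorder traversal -/

namespace OForest

variable {Λ : Type*}

/-- Deleting the first node, where the parents of the first `n` roots are regarded as deleted. -/
def advance : ℕ × OForest Λ → ℕ × OForest Λ
  | (n, nil) => (n, nil)
  | (n, cons _ c r) => (c.numRoots + (n - 1), c.append r)

/-- The forest below the first node. -/
def headChildren : OForest Λ → OForest Λ
  | nil => nil
  | cons _ c _ => c

/-- The whole forest for `0`, and the forest below the `i`-th node in preorder for `i + 1`. -/
def context (F : OForest Λ) : ℕ → OForest Λ
  | 0 => F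
  | i + 1 => headChildren (advance^[i] (0, F)).2

/-- The position in preorder behind the last node of a context. -/
def contextEnd (F : OForest Λ) (X : ℕ) : ℕ := X + (F.context X).size

/-- What remains of the context `X` after deletion of the nodes before position `j`. -/
def remainder (F : OForest Λ) (X j : ℕ) : ℕ × OForest Λ := advance^[j - X] (0, F.context X)

/-- Deleting all of `c` uses up exactly the counter of its roots. Hence skipping a matched subtree
leads to a state that the plain traversal also reaches. -/
theorem advance_iterate_size (c r : OForest Λ) (k : ℕ) :
    advance^[c.size] (c.numRoots + k, c.append r) = (k, r) := by
  induction c generalizing r k with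
  | nil => simp [size, numRoots]
  | cons x d e ihd ihe =>
    rw [show (cons x d e).size = e.size + (d.size + 1) by simp [size]; omega,
      Function.iterate_add_apply, Function.iterate_succ_apply, cons_append, advance,
      show (cons x d e).numRoots + k - 1 = e.numRoots + k by simp [numRoots]; omega,
      ihd, ihe]

/-- The counters do not influence which forest remains, and by `hi` the traversal does not enter
`R`. -/
theorem advance_iterate_append (i n n' : ℕ) (F R : OForest Λ) (hi : i ≤ F.size) :
    (advance^[i] (n, F.append R)).2 = (advance^[i] (n', F)).2.append R := by
  induction i generalizing n n' F with
  | zero => rfl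
  | succ i ih =>
    cases F with
    | nil => simp [size] at hi
    | cons x c r =>
      simp only [Function.iterate_succ_apply, cons_append, advance]
      rw [← append_assoc]
      refine ih _ _ _ ?_
      simp only [size, size_append] at *
      omega

theorem size_advance_iterate (i n : ℕ) (F : OForest Λ) :
    (advance^[i] (n, F)).2.size = F.size - i := by
  induction i generalizing n F with
  | zero => rfl
  | succ i ih =>
    cases F with
    | nil => simp only [Function.iterate_succ_apply, advance, ih]; simp [size]
    | cons x c r =>
      simp only [Function.iterate_succ_apply, advance, ih]
      simp only [size, size_append]
      omega

theorem preorderLabels_append (F G : OForest Λ) :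
    (F.append G).preorderLabels = F.preorderLabels ++ G.preorderLabels := by
  induction F with
  | nil => rfl
  | cons x c r _ ih => simp [preorderLabels, ih]

theorem preorderDegrees_append (F G : OForest Λ) :
    (F.append G).preorderDegrees = F.preorderDegrees ++ G.preorderDegrees := by
  induction F with
  | nil => rfl
  | cons x c r _ ih => simp [preorderDegrees, ih]

theorem length_preorderLabels (F : OForest Λ) : F.preorderLabels.length = F.size := by
  induction F with
  | nil => rfl
  | cons x c r ihc ihr => simp [preorderLabels, size, ihc, ihr]; omega

theorem preorderLabels_advance_iterate (i n : ℕ) (F : OForest Λ) :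
    (advance^[i] (n, F)).2.preorderLabels = F.preorderLabels.drop i := by
  induction i generalizing n F with
  | zero => rfl
  | succ i ih =>
    cases F with
    | nil => simp only [Function.iterate_succ_apply, advance, ih]; simp [preorderLabels]
    | cons x c r =>
      simp [Function.iterate_succ_apply, advance, ih, preorderLabels_append, preorderLabels]

theorem preorderDegrees_advance_iterate (i n : ℕ) (F : OForest Λ) :
    (advance^[i] (n, F)).2.preorderDegrees = F.preorderDegrees.drop i := by
  induction i generalizing n F with
  | zero => rfl
  | succ i ih =>
    cases F with
    | nil => simp only [Function.iterate_succ_apply, advance, ih]; simp [preorderDegrees]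
    | cons x c r =>
      simp [Function.iterate_succ_apply, advance, ih, preorderDegrees_append, preorderDegrees]

theorem eq_nil_of_size {F : OForest Λ} (h : F.size = 0) : F = nil := by
  cases F with
  | nil => rfl
  | cons x c r => simp [size] at h

theorem exists_eq_cons {F : OForest Λ} (h : 0 < F.size) : ∃ x c r, F = cons x c r := by
  cases F with
  | nil => simp [size] at h
  | cons x c r => exact ⟨x, c, r, rfl⟩

/-- A context is an initial piece of what the global traversal still has to visit, so positions
inside it are global preorder positions. -/
theorem exists_context_append (F : OForest Λ) {X : ℕ} (hX : X ≤ F.size) :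
    ∃ R, (advance^[X] (0, F)).2 = (F.context X).append R := by
  cases X with
  | zero => exact ⟨nil, by simp [context]⟩
  | succ i =>
    have h := size_advance_iterate i 0 F
    generalize hs : advance^[i] (0, F) = s at h
    obtain ⟨n, G⟩ := s
    obtain ⟨x, c, r, rfl⟩ := exists_eq_cons (F := G) (by simp only at h; omega)
    refine ⟨r, ?_⟩
    simp only [context, Function.iterate_succ_apply', hs, advance, headChildren]

theorem contextEnd_le (F : OForest Λ) {X : ℕ} (hX : X ≤ F.size) : F.contextEnd X ≤ F.size := by
  obtain ⟨R, hR⟩ := F.exists_context_append hX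
  have := congrArg size hR
  rw [size_advance_iterate, size_append] at this
  unfold contextEnd
  omega

theorem le_contextEnd (F : OForest Λ) (X : ℕ) : X ≤ F.contextEnd X := Nat.le_add_right _ _

@[simp] theorem contextEnd_zero (F : OForest Λ) : F.contextEnd 0 = F.size := Nat.zero_add _

theorem remainder_self (F : OForest Λ) (X : ℕ) : F.remainder X X = (0, F.context X) := by
  simp [remainder]

theorem size_remainder (F : OForest Λ) {X j : ℕ} (hj : X ≤ j) :
    (F.remainder X j).2.size = F.contextEnd X - j := by
  rw [remainder, size_advance_iterate, contextEnd]
  omega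

theorem remainder_contextEnd (F : OForest Λ) (X : ℕ) :
    (F.remainder X (F.contextEnd X)).2 = nil :=
  eq_nil_of_size (by rw [size_remainder F (le_contextEnd F X), Nat.sub_self])

theorem remainder_succ (F : OForest Λ) {X j : ℕ} (hj : X ≤ j) :
    F.remainder X (j + 1) = advance (F.remainder X j) := by
  rw [remainder, remainder, Nat.succ_sub hj, Function.iterate_succ_apply']

/-- The first node of a remainder is the node of the forest at the respective position. -/
theorem exists_remainder_eq (F : OForest Λ) {X j : ℕ} (hX : X ≤ F.size) (hj : X ≤ j)
    (hj' : j < F.contextEnd X) :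
    ∃ x r, (F.remainder X j).2 = cons x (F.context (j + 1)) r ∧
      F.remainder X (F.contextEnd (j + 1)) = ((F.remainder X j).1 - 1, r) ∧
      F.preorderLabels[j]? = some x ∧
      F.preorderDegrees.getD j 0 = (F.context (j + 1)).numRoots ∧
      F.contextEnd (j + 1) ≤ F.contextEnd X := by
  obtain ⟨R, hR⟩ := F.exists_context_append hX
  have hs := F.size_remainder hj
  generalize hrem : F.remainder X j = s at hs
  obtain ⟨n, G⟩ := s
  obtain ⟨x, c, r, rfl⟩ := exists_eq_cons (F := G) (by simp only at hs; omega)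
  have hfull : (advance^[j] (0, F)).2 = cons x c (r.append R) := by
    have h := advance_iterate_append (j - X) (advance^[X] (0, F)).1 0 (F.context X) R
      (by unfold contextEnd at hj'; omega)
    rw [← hR, Prod.mk.eta, ← Function.iterate_add_apply, Nat.sub_add_cancel hj] at h
    rw [h, show advance^[j - X] (0, F.context X) = _ from hrem]
    rfl
  have hc : F.context (j + 1) = c := by rw [context, hfull]; rfl
  have hl := preorderLabels_advance_iterate j 0 F
  have hd := preorderDegrees_advance_iterate j 0 F
  rw [hfull] at hl hd
  refine ⟨x, r, by rw [hc], ?_, ?_, ?_, ?_⟩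
  -- One step passes the node at `j`, and `c.size` further steps pass the forest below it.
  · have h : F.contextEnd (j + 1) - X = c.size + 1 + (j - X) := by
      rw [contextEnd, hc]; omega
    rw [remainder, h, Function.iterate_add_apply,
      show advance^[j - X] (0, F.context X) = _ from hrem,
      Function.iterate_succ_apply, advance, advance_iterate_size]
  · have := congrArg List.head? hl
    rw [List.head?_drop] at this
    simpa [preorderLabels] using this.symm
  · have := congrArg List.head? hd
    rw [List.head?_drop] at this
    rw [List.getD_eq_getElem?_getD, ← this, hc]
    simp [preorderDegrees]
  · simp only [size] at hs
    rw [contextEnd, hc]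
    omega

end OForest

theorem List.getD_flatMap_map {α β γ : Type*} (f : α → β → γ) (d : γ) (L : List α) (M : List β)
    {j k : ℕ} {x : α} {y : β} (hx : L[j]? = some x) (hy : M[k]? = some y) :
    (L.flatMap fun x => M.map fun y => f x y).getD (j * M.length + k) d = f x y := by
  induction L generalizing j with
  | nil => simp at hx
  | cons z L ih =>
    obtain ⟨hk, hy'⟩ := List.getElem?_eq_some_iff.1 hy
    rw [List.flatMap_cons, List.getD_eq_getElem?_getD]
    cases j with
    | zero =>
      simp only [List.getElem?_cons_zero, Option.some.injEq] at hx
      rw [List.getElem?_append_left (by simpa using hk)]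
      simp [hx, hy]
    | succ j =>
      rw [List.getElem?_append_right (by simp; nlinarith), List.length_map,
        show (j + 1) * M.length + k - M.length = j * M.length + k by
          rw [Nat.succ_mul]; omega,
        ← List.getD_eq_getElem?_getD]
      exact ih (by simpa using hx)

/-! ### The recursion as a table over contexts and positions -/

section Table

open OForest

variable {Λ : Type*} [MetricSpace Λ]

/-- The entries of the dynamic programming table for a pair of contexts. -/
noncomputable def contextTable (a b : ℝ) (F G : OForest Λ) (X Y j k : ℕ) : ℝ :=
  mappingDist a b (F.remainder X j).1 (F.remainder X j).2 (G.remainder Y k).1 (G.remainder Y k).2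

/-- The cost of deleting the node at position `j` of the context `X`. -/
noncomputable def nodeCost (a b : ℝ) (F : OForest Λ) (X j : ℕ) : ℝ :=
  b + if (F.remainder X j).1 = 0 then a else 0

variable {a b : ℝ} {F G : OForest Λ} {X Y j k : ℕ}

theorem contextTable_end_end :
    contextTable a b F G X Y (F.contextEnd X) (G.contextEnd Y) = 0 := by
  rw [contextTable, remainder_contextEnd, remainder_contextEnd, mappingDist]

theorem contextTable_end_right (hX : X ≤ F.size) (hj : X ≤ j) (hj' : j < F.contextEnd X) :
    contextTable a b F G X Y j (G.contextEnd Y) =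
      nodeCost a b F X j + contextTable a b F G X Y (j + 1) (G.contextEnd Y) := by
  obtain ⟨x, r, h, -⟩ := F.exists_remainder_eq hX hj hj'
  rw [contextTable, contextTable, nodeCost, remainder_contextEnd, remainder_succ F hj]
  generalize F.remainder X j = s at *
  obtain ⟨n, H⟩ := s
  simp only at h
  subst h
  rw [mappingDist]
  rfl

theorem contextTable_end_left (hY : Y ≤ G.size) (hk : Y ≤ k) (hk' : k < G.contextEnd Y) :
    contextTable a b F G X Y (F.contextEnd X) k =
      nodeCost a b G Y k + contextTable a b F G X Y (F.contextEnd X) (k + 1) := by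
  obtain ⟨y, r, h, -⟩ := G.exists_remainder_eq hY hk hk'
  rw [contextTable, contextTable, nodeCost, remainder_contextEnd, remainder_succ G hk]
  generalize G.remainder Y k = s at *
  obtain ⟨n, H⟩ := s
  simp only at h
  subst h
  rw [mappingDist]
  rfl

/-- The recursion never leaves the table: the forests below two matched nodes are fresh contexts,
and what follows them are remainders of the old ones. -/
theorem contextTable_eq_min (hX : X ≤ F.size) (hj : X ≤ j) (hj' : j < F.contextEnd X)
    (hY : Y ≤ G.size) (hk : Y ≤ k) (hk' : k < G.contextEnd Y) :
    contextTable a b F G X Y j k =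
      min (min (nodeCost a b F X j + contextTable a b F G X Y (j + 1) k)
        (nodeCost a b G Y k + contextTable a b F G X Y j (k + 1)))
        ((F.preorderLabels.flatMap fun x => G.preorderLabels.map fun y => dist x y).getD
            (j * G.size + k) 0 +
          contextTable a b F G (j + 1) (k + 1) (j + 1) (k + 1) +
          contextTable a b F G X Y (F.contextEnd (j + 1)) (G.contextEnd (k + 1))) := by
  obtain ⟨x, r, h, hr, hx, -, -⟩ := F.exists_remainder_eq hX hj hj'
  obtain ⟨y, r', h', hr', hy, -, -⟩ := G.exists_remainder_eq hY hk hk'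
  rw [← length_preorderLabels G, List.getD_flatMap_map _ _ _ _ hx hy]
  simp only [contextTable, nodeCost, hr, hr', remainder_self, remainder_succ F hj,
    remainder_succ G hk]
  generalize F.remainder X j = s at *
  generalize G.remainder Y k = s' at *
  obtain ⟨n, H⟩ := s
  obtain ⟨n', H'⟩ := s'
  simp only at h h'
  subst h h'
  rw [mappingDist]
  rfl

end Table

/-! ## Total correctness of programs -/

namespace RAM

/-- Started in `s`, the program halts, and `Q` holds of its running time and its final state. -/
def Ends (p : Program) (s : State) (Q : ℕ → State → Prop) : Prop :=
  ∃ t s', Run p s t s' ∧ Q t s'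

namespace Ends

variable {p q : Program} {s : State} {Q Q' : ℕ → State → Prop}

theorem mono (h : Ends p s Q) (hQ : ∀ t s', Q t s' → Q' t s') : Ends p s Q' := by
  obtain ⟨t, s', h₁, h₂⟩ := h
  exact ⟨t, s', h₁, hQ _ _ h₂⟩

theorem skip (h : Q 1 s) : Ends .skip s Q := ⟨_, _, .skip, h⟩

theorem nset {x : ℕ} {e : NExpr}
    (h : Q (e.time + 1) { s with nvar := Function.update s.nvar x (e.eval s) }) :
    Ends (.nset x e) s Q := ⟨_, _, .nset, h⟩

theorem nstore {A : ℕ} {i e : NExpr}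
    (h : Q (i.time + e.time + 1) { s with
      narr := Function.update s.narr A (Function.update (s.narr A) (i.eval s) (e.eval s)) }) :
    Ends (.nstore A i e) s Q := ⟨_, _, .nstore, h⟩

theorem rset {x : ℕ} {e : RExpr}
    (h : Q (e.time + 1) { s with rvar := Function.update s.rvar x (e.eval s) }) :
    Ends (.rset x e) s Q := ⟨_, _, .rset, h⟩

theorem rstore {A : ℕ} {i : NExpr} {e : RExpr}
    (h : Q (i.time + e.time + 1) { s with
      rarr := Function.update s.rarr A (Function.update (s.rarr A) (i.eval s) (e.eval s)) }) :
    Ends (.rstore A i e) s Q := ⟨_, _, .rstore, h⟩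

theorem seq (h : Ends p s fun t s' => Ends q s' fun t' => Q (t + t')) : Ends (.seq p q) s Q := by
  obtain ⟨t, s', h₁, t', s'', h₂, h₃⟩ := h
  exact ⟨_, _, .seq h₁ h₂, h₃⟩

theorem ite {c : Test} (h : c.Holds s → Ends p s fun t => Q (c.time + t))
    (h' : ¬ c.Holds s → Ends q s fun t => Q (c.time + t)) : Ends (.ite c p q) s Q := by
  by_cases hc : c.Holds s
  · obtain ⟨t, s', h₁, h₂⟩ := h hc
    exact ⟨_, _, .ite_true hc h₁, h₂⟩
  · obtain ⟨t, s', h₁, h₂⟩ := h' hc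
    exact ⟨_, _, .ite_false hc h₁, h₂⟩

/-- A loop with invariant `I`, whose first argument is the number of remaining iterations. -/
theorem while_loop {c : Test} {τ : ℕ} (I : ℕ → State → Prop) (h₀ : ∀ s, I 0 s → ¬ c.Holds s)
    (h₁ : ∀ i s, I (i + 1) s → c.Holds s ∧ Ends p s fun t s' => t ≤ τ ∧ I i s') {N : ℕ}
    (h : I N s) :
    Ends (.while c p) s fun t s' => t ≤ N * (τ + c.time) + c.time ∧ I 0 s' := by
  induction N generalizing s with
  | zero => exact ⟨_, _, .while_false (h₀ _ h), by simp, h⟩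
  | succ N ih =>
    obtain ⟨hc, t, s', hr, ht, hI⟩ := h₁ _ _ h
    obtain ⟨t', s'', hr', ht', hI'⟩ := ih hI
    exact ⟨_, _, .while_true hc hr hr', by rw [Nat.succ_mul]; omega, hI'⟩

end Ends

/-! ## The program

Natural-number variables: `0`, `1` sizes; `2`, `3` contexts; `4`, `5` positions in the contexts;
`6`, `7` numbers of roots, and of roots with a deleted parent, of a remainder. Natural-number arrays:
`0`, `1` degrees; `2`, `3` ends of the contexts; `4`, `5` multiples of the row lengths of the tables
and of the input matrix. Real variables: `0`, `1` the gap costs; `2`, `3` temporary. Real arrays: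
`0` relabeling costs; `1` results for pairs of contexts; `2` the table of the current pair;
`3`, `4` node costs in the current contexts. -/

/-- Stores the cost of the node at the position in variable `j`, and moves on. -/
def contextStep (A L j : ℕ) : Program :=
  .seq (.ite (.neq (.var 7) (.const 0)) (.rstore L (.var j) (.add (.var 1) (.var 0)))
    (.rstore L (.var j) (.var 1))) <|
  .seq (.nset 7 (.add (.arr A (.var j)) (.sub (.var 7) (.const 1)))) <|
  .seq (.nset 6 (.add (.arr A (.var j)) (.sub (.var 6) (.const 1)))) <|
  .nset j (.add (.var j) (.const 1))

/-- Computes the end of the context in variable `x` and its node costs. -/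
def contextProgram (x A E L j : ℕ) : Program :=
  .seq (.nset j (.var x)) <|
  .seq (.ite (.neq (.var x) (.const 0)) (.nset 6 (.const 1))
    (.nset 6 (.arr A (.sub (.var x) (.const 1))))) <|
  .seq (.nset 7 (.const 0)) <|
  .seq (.while (.nlt (.const 0) (.var 6)) (contextStep A L j)) <|
  .nstore E (.var x) (.var j)

/-- The degrees alone update the number of roots of the remainder, and the context ends when that
number reaches zero. Neither a stack nor the forest itself is stored. -/
theorem contextProgram_ends {Λ : Type*} {F : OForest Λ} (hF : F.numRoots = 1) {a b : ℝ}
    {x A E L j X : ℕ} {s : State} (hX : s.nvar x = X) (hle : X ≤ F.size)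
    (hA : ∀ i, s.narr A i = F.preorderDegrees.getD i 0) (ha : s.rvar 0 = a) (hb : s.rvar 1 = b)
    (hx₆ : x ≠ 6) (hx₇ : x ≠ 7) (hj₆ : j ≠ 6) (hj₇ : j ≠ 7) (hxj : x ≠ j) :
    Ends (contextProgram x A E L j) s fun t s' => t ≤ 60 * (F.size + 1) ∧
      ∃ nv l, s' = { s with
          nvar := nv
          narr := Function.update s.narr E (Function.update (s.narr E) X (F.contextEnd X))
          rarr := Function.update s.rarr L l } ∧
        (∀ y, y ≠ 6 → y ≠ 7 → y ≠ j → nv y = s.nvar y) ∧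
        ∀ i, X ≤ i → i < F.contextEnd X → l i = nodeCost a b F X i := by
  -- The context `X > 0` lies below the node at `X - 1`; the context `0` has one root by `hF`.
  have hroots : (if X = 0 then 1 else F.preorderDegrees.getD (X - 1) 0) =
      (F.context X).numRoots := by
    cases X with
    | zero => simpa [OForest.context] using hF.symm
    | succ i =>
      obtain ⟨x, r, -, -, -, h, -⟩ := F.exists_remainder_eq (X := 0) (j := i) (Nat.zero_le _)
        (Nat.zero_le _) (by rw [OForest.contextEnd_zero]; omega)
      simpa using h
  let I (i : ℕ) (s' : State) : Prop := ∃ nv l p, s' = { s with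
      nvar := nv
      rarr := Function.update s.rarr L l } ∧
    (∀ y, y ≠ 6 → y ≠ 7 → y ≠ j → nv y = s.nvar y) ∧ X ≤ p ∧ p + i = F.contextEnd X ∧
    nv j = p ∧ nv 6 = (F.remainder X p).2.numRoots ∧ nv 7 = (F.remainder X p).1 ∧
    ∀ i, X ≤ i → i < p → l i = nodeCost a b F X i
  have hinit : I (F.context X).size { s with
      nvar := Function.update (Function.update (Function.update s.nvar j X) 6
        (F.context X).numRoots) 7 0 } := by
    refine ⟨Function.update (Function.update (Function.update s.nvar j X) 6
      (F.context X).numRoots) 7 0, s.rarr L, X, by simp, ?_, le_rfl, rfl, ?_, ?_, ?_, ?_⟩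
    · intro y h6 h7 hj
      simp [h6, h7, hj]
    · simp [hj₆, hj₇]
    · simp [OForest.remainder_self]
    · simp [OForest.remainder_self]
    · intro i h h'
      omega
  have hloop := Ends.while_loop (c := .nlt (.const 0) (.var 6)) (τ := 40)
    (p := contextStep A L j) I ?_ ?_ hinit
  · refine .seq (.nset (.seq ?_))
    have hnext : Ends (.seq (.nset 7 (.const 0)) <|
        .seq (.while (.nlt (.const 0) (.var 6)) (contextStep A L j)) <|
        .nstore E (.var x) (.var j))
        { s with nvar := Function.update (Function.update s.nvar j X) 6 (F.context X).numRoots }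
        fun t s' => t + 10 ≤ 60 * (F.size + 1) ∧
          ∃ nv l, s' = { s with
              nvar := nv
              narr := Function.update s.narr E (Function.update (s.narr E) X (F.contextEnd X))
              rarr := Function.update s.rarr L l } ∧
            (∀ y, y ≠ 6 → y ≠ 7 → y ≠ j → nv y = s.nvar y) ∧
            ∀ i, X ≤ i → i < F.contextEnd X → l i = nodeCost a b F X i := by
      refine .seq (.nset (.seq (hloop.mono ?_)))
      rintro t' s' ⟨ht', nv, l, p, rfl, h₁, h₂, h₃, h₄, h₅, h₆, h₇⟩
      rw [add_zero] at h₃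
      have hnx : nv x = X := by rw [h₁ x hx₆ hx₇ hxj, hX]
      have hsz := F.contextEnd_le hle
      unfold OForest.contextEnd at hsz
      refine .nstore ⟨?_, nv, l, ?_, h₁, fun i hi hi' => h₇ i hi (h₃ ▸ hi')⟩
      · simp only [NExpr.time, Test.time] at *
        omega
      · simp [NExpr.eval, hnx, h₄, h₃]
    refine .ite (fun h => .nset ?_) (fun h => .nset ?_)
    · simp only [Test.Holds, NExpr.eval, hX, Function.update_of_ne hxj] at h
      rw [if_pos h] at hroots
      simp only [NExpr.eval, hX]
      rw [← hroots] at hnext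
      exact hnext.mono fun t s' h => ⟨by simp only [NExpr.time, Test.time]; omega, h.2⟩
    · simp only [Test.Holds, NExpr.eval, hX, Function.update_of_ne hxj] at h
      rw [if_neg h] at hroots
      simp only [NExpr.eval, hX, Function.update_of_ne hxj, hA, hroots]
      exact hnext.mono fun t s' h => ⟨by simp only [NExpr.time, Test.time]; omega, h.2⟩
  · rintro s' ⟨nv, l, p, rfl, h₁, h₂, h₃, h₄, h₅, h₆, h₇⟩
    rw [add_zero] at h₃
    subst h₃
    simp [Test.Holds, NExpr.eval, h₅, OForest.remainder_contextEnd, OForest.numRoots]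
  · rintro i s' ⟨nv, l, p, rfl, h₁, h₂, h₃, h₄, h₅, h₆, h₇⟩
    obtain ⟨y, r, hr, -, -, hdeg, -⟩ := F.exists_remainder_eq hle h₂ (by omega)
    rw [List.getD_eq_getElem?_getD] at hdeg
    have hsucc := F.remainder_succ h₂
    have hcost : nodeCost a b F X p = b + if (F.remainder X p).1 = 0 then a else 0 := rfl
    generalize F.remainder X p = u at *
    obtain ⟨n, G⟩ := u
    simp only at hr hcost h₅ h₆
    subst hr
    refine ⟨by simp [Test.Holds, NExpr.eval, h₅, OForest.numRoots], ?_⟩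
    have hnext : Ends (
        .seq (.nset 7 (.add (.arr A (.var j)) (.sub (.var 7) (.const 1)))) <|
        .seq (.nset 6 (.add (.arr A (.var j)) (.sub (.var 6) (.const 1)))) <|
        .nset j (.add (.var j) (.const 1)))
        { s with
          nvar := nv
          rarr := Function.update s.rarr L (Function.update l p (nodeCost a b F X p)) }
        fun t s' => t + 10 ≤ 40 ∧ I i s' := by
      refine .seq (.nset (.seq (.nset (.nset ⟨?_, _, _, p + 1, rfl, ?_, ?_, ?_, ?_, ?_, ?_, ?_⟩))))
      · simp only [NExpr.time]
        omega
      · intro y h6 h7 hj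
        simp [h6, h7, hj, h₁]
      · omega
      · omega
      · simp [NExpr.eval, h₄, hj₆, hj₇]
      · simp [NExpr.eval, h₄, h₅, hj₆, hj₇, hj₆.symm, hA, hdeg, hsucc, OForest.advance,
          OForest.numRoots]
      · simp [NExpr.eval, h₄, h₆, hj₇.symm, hA, hdeg, hsucc, OForest.advance]
      · intro i hi hi'
        by_cases hip : i = p
        · subst hip
          simp
        · rw [Function.update_of_ne hip]
          exact h₇ i hi (by omega)
    have hl : (Function.update s.rarr L l) L = l := by simp
    refine .seq (.ite (fun h => .rstore ?_) (fun h => .rstore ?_))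
    · simp only [Test.Holds, NExpr.eval, h₆] at h
      rw [if_pos h] at hcost
      simp only [NExpr.eval, RExpr.eval, h₄, hl, Function.update_idem, ha, hb]
      rw [hcost] at hnext
      exact hnext.mono fun t s' h => ⟨by simp only [NExpr.time, RExpr.time, Test.time]; omega, h.2⟩
    · simp only [Test.Holds, NExpr.eval, h₆] at h
      rw [if_neg h, add_zero] at hcost
      simp only [NExpr.eval, RExpr.eval, h₄, hl, Function.update_idem, hb]
      rw [hcost] at hnext
      exact hnext.mono fun t s' h => ⟨by simp only [NExpr.time, RExpr.time, Test.time]; omega, h.2⟩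

end RAM

namespace RAM

/-- Replaces the real variable `2` by its minimum with `e`. -/
def minProgram (e : RExpr) : Program :=
  .seq (.rset 3 e) (.ite (.rlt (.var 3) (.var 2)) (.rset 2 (.var 3)) .skip)

theorem minProgram_ends {e : RExpr} {s : State} {u v : ℝ} (he : e.eval s = v)
    (hu : s.rvar 2 = u) :
    Ends (minProgram e) s fun t s' => t ≤ e.time + 10 ∧
      s' = { s with rvar := Function.update (Function.update s.rvar 3 v) 2 (min u v) } := by
  refine .seq (.rset (.ite (fun h => .rset ⟨?_, ?_⟩) fun h => .skip ⟨?_, ?_⟩))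
  · simp only [RExpr.time, Test.time]
    omega
  · simp only [Test.Holds, RExpr.eval, he, hu, Function.update_self,
      Function.update_of_ne (show (2 : ℕ) ≠ 3 by decide)] at h ⊢
    rw [min_eq_right h.le]
  · simp only [RExpr.time, Test.time]
    omega
  · simp only [Test.Holds, RExpr.eval, he, hu, Function.update_self,
      Function.update_of_ne (show (2 : ℕ) ≠ 3 by decide)] at h ⊢
    rw [min_eq_left (not_lt.1 h), ← hu]
    congr 1
    funext x
    by_cases hx : x = 2
    · simp [hx]
    · simp [Function.update_of_ne hx]

/-- The cost of inserting the current node of the second context first. -/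
def insertExpr : RExpr :=
  .add (.arr 4 (.var 5)) (.arr 2 (.add (.arr 4 (.var 4)) (.add (.var 5) (.const 1))))

/-- The cost of deleting the current node of the first context first. -/
def deleteExpr : RExpr :=
  .add (.arr 3 (.var 4)) (.arr 2 (.add (.arr 4 (.add (.var 4) (.const 1))) (.var 5)))

/-- The cost of mapping the current nodes to each other. -/
def matchExpr : RExpr :=
  .add (.add (.arr 0 (.add (.arr 5 (.var 4)) (.var 5)))
    (.arr 1 (.add (.arr 4 (.add (.var 4) (.const 1))) (.add (.var 5) (.const 1)))))
    (.arr 2 (.add (.arr 4 (.arr 2 (.add (.var 4) (.const 1))))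
      (.arr 3 (.add (.var 5) (.const 1)))))

/-- Computes a table entry in the real variable `2`. -/
def entryProgram : Program :=
  .ite (.nlt (.var 4) (.arr 2 (.var 2)))
    (.seq (.rset 2 deleteExpr) <|
      .ite (.nlt (.var 5) (.arr 3 (.var 3)))
        (.seq (minProgram insertExpr) (minProgram matchExpr)) .skip)
    (.ite (.nlt (.var 5) (.arr 3 (.var 3))) (.rset 2 insertExpr) (.rset 2 .zero))

/-- Computes and stores a table entry. -/
def cellProgram : Program :=
  .seq entryProgram (.rstore 2 (.add (.arr 4 (.var 4)) (.var 5)) (.var 2))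

/-- Fills a row of the table. -/
def rowProgram : Program :=
  .seq (.nset 5 (.add (.arr 3 (.var 3)) (.const 1))) <|
  .while (.nlt (.var 3) (.var 5)) (.seq (.nset 5 (.sub (.var 5) (.const 1))) cellProgram)

/-- Fills the table of a pair of contexts. -/
def tableProgram : Program :=
  .seq (.nset 4 (.add (.arr 2 (.var 2)) (.const 1))) <|
  .while (.nlt (.var 2) (.var 4)) (.seq (.nset 4 (.sub (.var 4) (.const 1))) rowProgram)

/-- Computes the results for all pairs with a given first context. -/
def secondProgram : Program :=
  .seq (.nset 3 (.add (.var 1) (.const 1))) <|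
  .while (.nlt (.const 0) (.var 3)) <|
    .seq (.nset 3 (.sub (.var 3) (.const 1))) <|
    .seq (contextProgram 3 1 3 4 5) <|
    .seq tableProgram <|
    .rstore 1 (.add (.arr 4 (.var 2)) (.var 3)) (.arr 2 (.add (.arr 4 (.var 2)) (.var 3)))

/-- Computes the results for all pairs of contexts. -/
def firstProgram : Program :=
  .seq (.nset 2 (.add (.var 0) (.const 1))) <|
  .while (.nlt (.const 0) (.var 2)) <|
    .seq (.nset 2 (.sub (.var 2) (.const 1))) <|
    .seq (contextProgram 2 0 2 3 4) secondProgram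

/-- Computes the multiples of the row lengths. -/
def prepareProgram : Program :=
  .seq (.nset 4 (.const 0)) <|
  .while (.nlt (.var 4) (.var 0)) <|
    .seq (.nstore 4 (.add (.var 4) (.const 1))
      (.add (.arr 4 (.var 4)) (.add (.var 1) (.const 1)))) <|
    .seq (.nstore 5 (.add (.var 4) (.const 1)) (.add (.arr 5 (.var 4)) (.var 1))) <|
    .nset 4 (.add (.var 4) (.const 1))

/-- The program computing the gap edit distance. -/
def gapProgram : Program :=
  .seq prepareProgram <| .seq firstProgram <| .rset 0 (.arr 1 (.const 0))

/-! ### Invariants and running time of the program -/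

section Correctness

open OForest

variable {Λ : Type*} [MetricSpace Λ]

/-- The input, with the multiples of the row lengths. -/
structure Prepared (a b : ℝ) (F G : OForest Λ) (s : State) : Prop where
  size₁ : s.nvar 0 = F.size
  size₂ : s.nvar 1 = G.size
  degrees₁ : ∀ i, s.narr 0 i = F.preorderDegrees.getD i 0
  degrees₂ : ∀ i, s.narr 1 i = G.preorderDegrees.getD i 0
  open_cost : s.rvar 0 = a
  node_cost : s.rvar 1 = b
  relabel : ∀ i, s.rarr 0 i =
    (F.preorderLabels.flatMap fun x => G.preorderLabels.map fun y => dist x y).getD i 0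
  row : ∀ j ≤ F.size, s.narr 4 j = j * (G.size + 1)
  input_row : ∀ j ≤ F.size, s.narr 5 j = j * G.size

/-- The data of the first context are computed. -/
structure InFirst (a b : ℝ) (F G : OForest Λ) (X : ℕ) (s : State) : Prop
    extends Prepared a b F G s where
  le₁ : X ≤ F.size
  var₁ : s.nvar 2 = X
  end₁ : ∀ i, X ≤ i → i ≤ F.size → s.narr 2 i = F.contextEnd i
  cost₁ : ∀ i, X ≤ i → i < F.contextEnd X → s.rarr 3 i = nodeCost a b F X i

/-- The data of both contexts are computed. -/
structure InSecond (a b : ℝ) (F G : OForest Λ) (X Y : ℕ) (s : State) : Prop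
    extends InFirst a b F G X s where
  le₂ : Y ≤ G.size
  var₂ : s.nvar 3 = Y
  end₂ : ∀ i, Y ≤ i → i ≤ G.size → s.narr 3 i = G.contextEnd i
  cost₂ : ∀ i, Y ≤ i → i < G.contextEnd Y → s.rarr 4 i = nodeCost a b G Y i

/-- The results for the pairs of contexts from `(X, Y)` on (lexicographically) are computed. -/
def ResultsFrom (a b : ℝ) (F G : OForest Λ) (X Y : ℕ) (s : State) : Prop :=
  ∀ i k, i ≤ F.size → k ≤ G.size → (X < i ∨ i = X ∧ Y ≤ k) →
    s.rarr 1 (i * (G.size + 1) + k) = contextTable a b F G i k i k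

/-- The table of the contexts `X` and `Y` is filled from `(j, k)` on (lexicographically). -/
def TableFrom (a b : ℝ) (F G : OForest Λ) (X Y j k : ℕ) (s : State) : Prop :=
  ∀ i l, i ≤ F.contextEnd X → Y ≤ l → l ≤ G.contextEnd Y →
    (j < i ∨ i = j ∧ k ≤ l) →
    s.rarr 2 (i * (G.size + 1) + l) = contextTable a b F G X Y i l

variable {a b : ℝ} {F G : OForest Λ} {X Y j k : ℕ} {s : State}

theorem InFirst.frame (h : InFirst a b F G X s) {s' : State}
    (hn : ∀ x < 3, s'.nvar x = s.nvar x) (ha : ∀ A, A ≠ 3 → s'.narr A = s.narr A)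
    (hr : ∀ x < 2, s'.rvar x = s.rvar x) (hra : ∀ A, A = 0 ∨ A = 3 → s'.rarr A = s.rarr A) :
    InFirst a b F G X s' where
  size₁ := by rw [hn 0 (by decide), h.size₁]
  size₂ := by rw [hn 1 (by decide), h.size₂]
  degrees₁ := by rw [ha 0 (by decide)]; exact h.degrees₁
  degrees₂ := by rw [ha 1 (by decide)]; exact h.degrees₂
  open_cost := by rw [hr 0 (by decide), h.open_cost]
  node_cost := by rw [hr 1 (by decide), h.node_cost]
  relabel := by rw [hra 0 (by decide)]; exact h.relabel
  row := by rw [ha 4 (by decide)]; exact h.row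
  input_row := by rw [ha 5 (by decide)]; exact h.input_row
  le₁ := h.le₁
  var₁ := by rw [hn 2 (by decide), h.var₁]
  end₁ := by rw [ha 2 (by decide)]; exact h.end₁
  cost₁ := by rw [hra 3 (by decide)]; exact h.cost₁

theorem InSecond.frame (h : InSecond a b F G X Y s) {s' : State}
    (hn : ∀ x < 4, s'.nvar x = s.nvar x) (ha : s'.narr = s.narr)
    (hr : ∀ x < 2, s'.rvar x = s.rvar x)
    (hra : ∀ A, A = 0 ∨ A = 3 ∨ A = 4 → s'.rarr A = s.rarr A) :
    InSecond a b F G X Y s' where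
  toInFirst := h.toInFirst.frame (fun x hx => hn x (by omega)) (fun A _ => by rw [ha]) hr
    fun A hA => hra A (by omega)
  le₂ := h.le₂
  var₂ := by rw [hn 3 (by decide), h.var₂]
  end₂ := by rw [ha]; exact h.end₂
  cost₂ := by rw [hra 4 (by decide)]; exact h.cost₂

/-- All values read are lexicographically later: they lie in the same table at a later entry, or
belong to the contexts `j + 1` and `k + 1`, where `j + 1 > X`. -/
theorem entryProgram_ends (h : InSecond a b F G X Y s) (hD : ResultsFrom a b F G X (Y + 1) s)
    (hW : TableFrom a b F G X Y j (k + 1) s) (hj : s.nvar 4 = j) (hk : s.nvar 5 = k)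
    (hXj : X ≤ j) (hjX : j ≤ F.contextEnd X) (hYk : Y ≤ k) (hkY : k ≤ G.contextEnd Y) :
    Ends entryProgram s fun t s' => t ≤ 90 ∧ ∃ r, s' = { s with rvar := r } ∧
      (∀ x < 2, r x = s.rvar x) ∧ r 2 = contextTable a b F G X Y j k := by
  have hX := F.contextEnd_le h.le₁
  have hY := G.contextEnd_le h.le₂
  have hins (hk' : k < G.contextEnd Y) : insertExpr.eval s =
      nodeCost a b G Y k + contextTable a b F G X Y j (k + 1) := by
    simp only [insertExpr, RExpr.eval, NExpr.eval, hj, hk, h.row j (by omega), h.cost₂ k hYk hk']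
    rw [hW j (k + 1) hjX (by omega) hk' (.inr ⟨rfl, le_rfl⟩)]
  have hdel (hj' : j < F.contextEnd X) : deleteExpr.eval s =
      nodeCost a b F X j + contextTable a b F G X Y (j + 1) k := by
    simp only [deleteExpr, RExpr.eval, NExpr.eval, hj, hk, h.row (j + 1) (by omega),
      h.cost₁ j hXj hj']
    rw [hW (j + 1) k hj' hYk hkY (.inl j.lt_succ_self)]
  refine .ite (fun hj' => .seq (.rset (.ite (fun hk' => .seq ?_) fun hk' => .skip ?_))) fun hj' =>
    .ite (fun hk' => .rset ?_) fun hk' => .rset ?_ <;>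
    simp only [Test.Holds, NExpr.eval, hj, hk, h.var₁, h.var₂, h.end₁ X le_rfl h.le₁,
      h.end₂ Y le_rfl h.le₂] at hj' hk'
  · refine Ends.mono (minProgram_ends (hins hk') (by
    simp only [Function.update_self]; exact hdel hj')) ?_
    rintro t s' ⟨ht, rfl⟩
    obtain ⟨-, -, -, -, -, -, he⟩ := F.exists_remainder_eq h.le₁ hXj hj'
    obtain ⟨-, -, -, -, -, -, he'⟩ := G.exists_remainder_eq h.le₂ hYk hk'
    have hmatch : matchExpr.eval s =
        (F.preorderLabels.flatMap fun x => G.preorderLabels.map fun y => dist x y).getD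
            (j * G.size + k) 0 + contextTable a b F G (j + 1) (k + 1) (j + 1) (k + 1) +
          contextTable a b F G X Y (F.contextEnd (j + 1)) (G.contextEnd (k + 1)) := by
      simp only [matchExpr, RExpr.eval, NExpr.eval, hj, hk, h.row (j + 1) (by omega),
        h.input_row j (by omega), h.end₁ (j + 1) (by omega) (by omega),
        h.end₂ (k + 1) (by omega) (by omega), h.row (F.contextEnd (j + 1)) (by omega), h.relabel]
      rw [hD (j + 1) (k + 1) (by omega) (by omega) (.inl (by omega)),
        hW _ _ he (hYk.trans (by have := G.le_contextEnd (k + 1); omega)) he'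
          (.inl (F.le_contextEnd (j + 1)))]
    refine Ends.mono (minProgram_ends (u := min
      (nodeCost a b F X j + contextTable a b F G X Y (j + 1) k)
      (nodeCost a b G Y k + contextTable a b F G X Y j (k + 1))) hmatch (by
        simp only [Function.update_self])) ?_
    rintro t' s' ⟨ht', rfl⟩
    refine ⟨?_, _, rfl, ?_, ?_⟩
    · simp only [insertExpr, deleteExpr, matchExpr, RExpr.time, NExpr.time, Test.time] at *
      omega
    · intro x hx
      simp [show x ≠ 2 by omega, show x ≠ 3 by omega]
    · rw [contextTable_eq_min h.le₁ hXj hj' h.le₂ hYk hk', Function.update_self]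
  · refine ⟨?_, _, rfl, ?_, ?_⟩
    · simp [deleteExpr, RExpr.time, NExpr.time, Test.time]
    · intro x hx
      simp [show x ≠ 2 by omega]
    · obtain rfl : k = G.contextEnd Y := by omega
      rw [contextTable_end_right h.le₁ hXj hj', Function.update_self, hdel hj']
  · refine ⟨?_, _, rfl, ?_, ?_⟩
    · simp [insertExpr, RExpr.time, NExpr.time, Test.time]
    · intro x hx
      simp [show x ≠ 2 by omega]
    · obtain rfl : j = F.contextEnd X := by omega
      rw [contextTable_end_left h.le₂ hYk hk', Function.update_self, hins hk']
  · refine ⟨?_, _, rfl, ?_, ?_⟩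
    · simp [RExpr.time, NExpr.time, Test.time]
    · intro x hx
      simp [show x ≠ 2 by omega]
    · obtain rfl : j = F.contextEnd X := by omega
      obtain rfl : k = G.contextEnd Y := by omega
      rw [contextTable_end_end, Function.update_self]
      rfl

theorem cellProgram_ends (h : InSecond a b F G X Y s) (hD : ResultsFrom a b F G X (Y + 1) s)
    (hW : TableFrom a b F G X Y j (k + 1) s) (hj : s.nvar 4 = j) (hk : s.nvar 5 = k)
    (hXj : X ≤ j) (hjX : j ≤ F.contextEnd X) (hYk : Y ≤ k) (hkY : k ≤ G.contextEnd Y) :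
    Ends cellProgram s fun t s' => t ≤ 100 ∧ InSecond a b F G X Y s' ∧
      ResultsFrom a b F G X (Y + 1) s' ∧ TableFrom a b F G X Y j k s' ∧ s'.nvar = s.nvar := by
  have hX := F.contextEnd_le h.le₁
  have hY := G.contextEnd_le h.le₂
  refine .seq ((entryProgram_ends h hD hW hj hk hXj hjX hYk hkY).mono ?_)
  rintro t s' ⟨ht, r, rfl, hr, hr₂⟩
  refine .rstore ⟨?_, h.frame (fun _ _ => rfl) rfl hr ?_, ?_, ?_, rfl⟩
  · simp only [RExpr.time, NExpr.time]
    omega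
  · rintro A (rfl | rfl | rfl) <;> simp
  · intro i l hi hl hil
    simpa using hD i l hi hl hil
  · intro i l hi hYl hl hil
    simp only [NExpr.eval, RExpr.eval, hj, hk, hr₂, h.row j (by omega), Function.update_self]
    by_cases hc : i = j ∧ l = k
    · rw [hc.1, hc.2, Function.update_self]
    · rw [Function.update_of_ne, hW i l hi hYl hl (by omega)]
      -- Columns are at most `G.size`, which is below the row length `G.size + 1`, so distinct
      -- entries have distinct addresses.
      intro he
      rcases lt_or_ge j i with hji | hji
      · have := Nat.mul_le_mul_right (G.size + 1) hji
        rw [Nat.succ_mul] at this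
        omega
      · obtain rfl : i = j := by omega
        omega

theorem rowProgram_ends (h : InSecond a b F G X Y s) (hD : ResultsFrom a b F G X (Y + 1) s)
    (hW : TableFrom a b F G X Y (j + 1) Y s) (hj : s.nvar 4 = j)
    (hXj : X ≤ j) (hjX : j ≤ F.contextEnd X) :
    Ends rowProgram s fun t s' => t ≤ 115 * (G.size + 1) ∧ InSecond a b F G X Y s' ∧
      ResultsFrom a b F G X (Y + 1) s' ∧ TableFrom a b F G X Y j Y s' ∧ s'.nvar 4 = j := by
  have hY := G.contextEnd_le h.le₂
  have hY' := G.le_contextEnd Y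
  refine .seq (.nset (Ends.mono (Ends.while_loop (τ := 104) (N := G.contextEnd Y + 1 - Y)
    (fun i s' => InSecond a b F G X Y s' ∧ ResultsFrom a b F G X (Y + 1) s' ∧
      TableFrom a b F G X Y j (Y + i) s' ∧ s'.nvar 4 = j ∧ s'.nvar 5 = Y + i ∧
      Y + i ≤ G.contextEnd Y + 1) ?_ ?_ ⟨?_, fun i => hD i, ?_, ?_, ?_, ?_⟩) ?_))
  · rintro s' ⟨h, -, -, -, hk, -⟩
    simp [Test.Holds, NExpr.eval, h.var₂, hk]
  · rintro i s' ⟨h, hD, hW, hj, hk, hi⟩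
    refine ⟨by simp [Test.Holds, NExpr.eval, h.var₂, hk], .seq (.nset ?_)⟩
    refine Ends.mono (cellProgram_ends (k := Y + i) (j := j) (h.frame ?_ rfl (fun _ _ => rfl)
      fun _ _ => rfl) hD hW ?_ ?_ hXj hjX (by omega) (by omega)) ?_
    · intro x hx
      simp [show x ≠ 5 by omega]
    · simpa using hj
    · simp [NExpr.eval, hk]
    · rintro t s' ⟨ht, h, hD, hW, hn⟩
      refine ⟨?_, h, hD, hW, ?_, ?_, by omega⟩
      · simp only [NExpr.time]
        omega
      · simpa [hn] using hj
      · simp [hn, NExpr.eval, hk]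
  · refine h.frame ?_ rfl (fun _ _ => rfl) fun _ _ => rfl
    intro x hx
    simp [show x ≠ 5 by omega]
  -- Beyond the last column row `j` is empty, so nothing but the later rows is claimed initially.
  · intro i l hi hYl hl hil
    exact hW i l hi hYl hl (by omega)
  · simpa using hj
  · simp [NExpr.eval, h.var₂, h.end₂ Y le_rfl h.le₂]
    omega
  · omega
  · rintro t s' ⟨ht, h, hD, hW, hj, -⟩
    refine ⟨?_, h, hD, hW, hj⟩
    simp only [NExpr.time, Test.time] at *
    omega

theorem tableProgram_ends (h : InSecond a b F G X Y s) (hD : ResultsFrom a b F G X (Y + 1) s) :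
    Ends tableProgram s fun t s' => t ≤ 140 * ((F.size + 1) * (G.size + 1)) ∧
      InSecond a b F G X Y s' ∧ ResultsFrom a b F G X (Y + 1) s' ∧
      TableFrom a b F G X Y X Y s' := by
  have hX := F.contextEnd_le h.le₁
  have hX' := F.le_contextEnd X
  refine .seq (.nset (Ends.mono (Ends.while_loop (τ := 120 * (G.size + 1))
    (N := F.contextEnd X + 1 - X)
    (fun i s' => InSecond a b F G X Y s' ∧ ResultsFrom a b F G X (Y + 1) s' ∧
      TableFrom a b F G X Y (X + i) Y s' ∧ s'.nvar 4 = X + i ∧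
      X + i ≤ F.contextEnd X + 1) ?_ ?_ ⟨?_, fun i => hD i, ?_, ?_, ?_⟩) ?_))
  · rintro s' ⟨h, -, -, hj, -⟩
    simp [Test.Holds, NExpr.eval, h.var₁, hj]
  · rintro i s' ⟨h, hD, hW, hj, hi⟩
    refine ⟨by simp [Test.Holds, NExpr.eval, h.var₁, hj], .seq (.nset ?_)⟩
    refine Ends.mono (rowProgram_ends (j := X + i) (h.frame ?_ rfl (fun _ _ => rfl)
      fun _ _ => rfl) hD hW ?_ (by omega) (by omega)) ?_
    · intro x hx
      simp [show x ≠ 4 by omega]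
    · simp [NExpr.eval, hj]
    · rintro t s' ⟨ht, h, hD, hW, hj⟩
      refine ⟨?_, h, hD, hW, hj, by omega⟩
      simp only [NExpr.time]
      omega
  · refine h.frame ?_ rfl (fun _ _ => rfl) fun _ _ => rfl
    intro x hx
    simp [show x ≠ 4 by omega]
  · intro i l hi hYl hl hil
    omega
  · simp [NExpr.eval, h.var₁, h.end₁ X le_rfl h.le₁]
    omega
  · omega
  · rintro t s' ⟨ht, h, hD, hW, -⟩
    refine ⟨?_, h, hD, hW⟩
    simp only [NExpr.time, Test.time] at *
    have h₁ := Nat.mul_le_mul (show F.contextEnd X + 1 - X ≤ F.size + 1 by omega)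
      (show 120 * (G.size + 1) + (1 + 1 + 1) ≤ 123 * (G.size + 1) by omega)
    have h₂ := Nat.mul_pos F.size.succ_pos G.size.succ_pos
    rw [Nat.mul_left_comm] at h₁
    simp only [Nat.succ_eq_add_one] at h₂
    omega

/-- As `Y` decreases, the ends of all later contexts, needed to skip matched subtrees, are already
stored. Every `Y` costs one table, which dominates the linear scan of the context. -/
theorem secondProgram_ends (hG : G.numRoots = 1) (h : InFirst a b F G X s)
    (hD : ResultsFrom a b F G (X + 1) 0 s) :
    Ends secondProgram s fun t s' => t ≤ 250 * ((F.size + 1) * (G.size + 1) * (G.size + 1)) ∧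
      InFirst a b F G X s' ∧ ResultsFrom a b F G X 0 s' := by
  have hpos := Nat.mul_pos F.size.succ_pos G.size.succ_pos
  have hpos' := Nat.mul_pos hpos G.size.succ_pos
  simp only [Nat.succ_eq_add_one] at hpos hpos'
  refine .seq (.nset (Ends.mono (Ends.while_loop (τ := 230 * ((F.size + 1) * (G.size + 1)))
    (N := G.size + 1)
    (fun Y s' => InFirst a b F G X s' ∧ ResultsFrom a b F G X Y s' ∧ s'.nvar 3 = Y ∧
      Y ≤ G.size + 1 ∧ ∀ i, Y ≤ i → i ≤ G.size → s'.narr 3 i = G.contextEnd i)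
    ?_ ?_ ⟨?_, ?_, ?_, le_rfl, fun i _ _ => by omega⟩) ?_))
  · rintro s' ⟨-, -, h, -⟩
    simp [Test.Holds, NExpr.eval, h]
  · rintro Y s' ⟨h, hD, hY, hle, he⟩
    refine ⟨by simp [Test.Holds, NExpr.eval, hY], .seq (.nset (.seq ?_))⟩
    refine Ends.mono (contextProgram_ends (x := 3) (A := 1) (E := 3) (L := 4) (j := 5) hG (X := Y)
      (a := a) (b := b) (by simp [NExpr.eval, hY])
      (by omega) h.degrees₂ h.open_cost h.node_cost (by decide) (by decide) (by decide)
      (by decide) (by decide)) ?_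
    rintro t s' ⟨ht, nv, l, rfl, hn, hl⟩
    have hn₃ : nv 3 = Y := by
      rw [hn 3 (by decide) (by decide) (by decide)]
      simp [NExpr.eval, hY]
    have h' : InFirst a b F G X { s' with
        nvar := nv
        narr := Function.update s'.narr 3 (Function.update (s'.narr 3) Y (G.contextEnd Y))
        rarr := Function.update s'.rarr 4 l } := by
      refine h.frame ?_ ?_ (fun _ _ => rfl) ?_
      · intro x hx
        simp [hn x (by omega) (by omega) (by omega), show x ≠ 3 by omega]
      · intro A hA
        simp [hA]
      · rintro A (rfl | rfl) <;> simp
    refine .seq ((tableProgram_ends (Y := Y) ⟨h', by omega, hn₃, ?_, ?_⟩ hD).mono ?_)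
    · intro i hi hi'
      by_cases hc : i = Y
      · simp [hc]
      · simpa [hc] using he i (by omega) hi'
    · intro i hi hi'
      simpa using hl i hi hi'
    · rintro t' s' ⟨ht', h, hD, hW⟩
      refine .rstore ⟨?_, h.toInFirst.frame (fun _ _ => rfl) (fun _ _ => rfl) (fun _ _ => rfl) ?_,
        ?_, h.var₂, by omega, h.end₂⟩
      · have := Nat.le_mul_of_pos_left (G.size + 1) F.size.succ_pos
        simp only [Nat.succ_eq_add_one] at this
        simp only [NExpr.time, RExpr.time]
        omega
      · rintro A (rfl | rfl) <;> simp
      · intro i k hi hk hik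
        simp only [NExpr.eval, RExpr.eval, h.var₁, h.var₂, h.row X h.le₁, Function.update_self]
        by_cases hc : i = X ∧ k = Y
        · rw [hc.1, hc.2, Function.update_self]
          exact hW X Y (F.le_contextEnd X) le_rfl (G.le_contextEnd Y) (.inr ⟨rfl, le_rfl⟩)
        · rw [Function.update_of_ne, hD i k hi hk (by omega)]
          intro he
          rcases hik with hji | hji
          · have := Nat.mul_le_mul_right (G.size + 1) hji
            rw [Nat.succ_mul] at this
            have := h.le₂
            omega
          · obtain rfl : i = X := hji.1
            omega
  · refine h.frame ?_ (fun _ _ => rfl) (fun _ _ => rfl) fun _ _ => rfl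
    intro x hx
    simp [show x ≠ 3 by omega]
  · intro i k hi hk hik
    exact hD i k hi hk (by omega)
  · simp [NExpr.eval, h.size₂]
  · rintro t s' ⟨ht, h, hD, -⟩
    refine ⟨?_, h, hD⟩
    simp only [NExpr.time, Test.time] at *
    have h₁ := Nat.mul_le_mul_left (G.size + 1)
      (show 230 * ((F.size + 1) * (G.size + 1)) + (1 + 1 + 1) ≤
        233 * ((F.size + 1) * (G.size + 1)) by omega)
    rw [Nat.mul_comm (G.size + 1) (233 * _), Nat.mul_assoc 233] at h₁
    omega

/-- The last pair of contexts treated is `(0, 0)`, that is, the pair of whole forests. -/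
theorem firstProgram_ends (hF : F.numRoots = 1) (hG : G.numRoots = 1)
    (h : Prepared a b F G s) :
    Ends firstProgram s fun t s' =>
      t ≤ 350 * ((F.size + 1) * (G.size + 1) * (G.size + 1) * (F.size + 1)) ∧
      s'.rarr 1 0 = mappingDist a b 0 F 0 G := by
  have hpos := Nat.mul_pos (Nat.mul_pos F.size.succ_pos G.size.succ_pos) G.size.succ_pos
  have hpos' := Nat.mul_pos hpos F.size.succ_pos
  simp only [Nat.succ_eq_add_one] at hpos hpos'
  refine .seq (.nset (Ends.mono (Ends.while_loop
    (τ := 330 * ((F.size + 1) * (G.size + 1) * (G.size + 1))) (N := F.size + 1)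
    (fun X s' => Prepared a b F G s' ∧ ResultsFrom a b F G X 0 s' ∧ s'.nvar 2 = X ∧
      X ≤ F.size + 1 ∧ ∀ i, X ≤ i → i ≤ F.size → s'.narr 2 i = F.contextEnd i)
    ?_ ?_ ⟨?_, ?_, ?_, le_rfl, fun i _ _ => by omega⟩) ?_))
  · rintro s' ⟨-, -, h, -⟩
    simp [Test.Holds, NExpr.eval, h]
  · rintro X s' ⟨h, hD, hX, hle, he⟩
    refine ⟨by simp [Test.Holds, NExpr.eval, hX], .seq (.nset (.seq ?_))⟩
    refine Ends.mono (contextProgram_ends (x := 2) (A := 0) (E := 2) (L := 3) (j := 4) hF (X := X)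
      (a := a) (b := b) (by simp [NExpr.eval, hX])
      (by omega) h.degrees₁ h.open_cost h.node_cost (by decide) (by decide) (by decide)
      (by decide) (by decide)) ?_
    rintro t s' ⟨ht, nv, l, rfl, hn, hl⟩
    have hn' {x : ℕ} (hx : x < 4) (hx' : x ≠ 2) : nv x = s'.nvar x := by
      rw [hn x (by omega) (by omega) (by omega)]
      simp [hx']
    refine Ends.mono (secondProgram_ends (X := X) hG ?_ hD) ?_
    · exact
      { size₁ := (hn' (by decide) (by decide)).trans h.size₁
        size₂ := (hn' (by decide) (by decide)).trans h.size₂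
        degrees₁ := by simpa using h.degrees₁
        degrees₂ := by simpa using h.degrees₂
        open_cost := h.open_cost
        node_cost := h.node_cost
        relabel := by simpa using h.relabel
        row := by simpa using h.row
        input_row := by simpa using h.input_row
        le₁ := by omega
        var₁ := by
          simp only [hn 2 (by decide) (by decide) (by decide)]
          simp [NExpr.eval, hX]
        end₁ := by
          intro i hi hi'
          by_cases hc : i = X
          · simp [hc]
          · simpa [hc] using he i (by omega) hi'
        cost₁ := by
          intro i hi hi'
          simpa using hl i hi hi' }
    · rintro t' s' ⟨ht', h, hD⟩
      refine ⟨?_, h.toPrepared, hD, h.var₁, by omega, h.end₁⟩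
      have h₁ := Nat.le_mul_of_pos_right (F.size + 1)
        (Nat.mul_pos G.size.succ_pos G.size.succ_pos)
      simp only [Nat.succ_eq_add_one, ← Nat.mul_assoc] at h₁
      simp only [NExpr.time]
      omega
  · exact { h with
      size₁ := by simpa using h.size₁
      size₂ := by simpa using h.size₂ }
  · intro i k hi hk hik
    omega
  · simp [NExpr.eval, h.size₁]
  · rintro t s' ⟨ht, h, hD, -⟩
    constructor
    · simp only [NExpr.time, Test.time] at *
      have h₁ := Nat.mul_le_mul_left (F.size + 1)
        (show 330 * ((F.size + 1) * (G.size + 1) * (G.size + 1)) + (1 + 1 + 1) ≤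
          333 * ((F.size + 1) * (G.size + 1) * (G.size + 1)) by omega)
      rw [Nat.mul_comm (F.size + 1) (333 * _), Nat.mul_assoc 333] at h₁
      omega
    · simpa [contextTable, remainder_self, context] using
        hD 0 0 (Nat.zero_le _) (Nat.zero_le _) (.inr ⟨rfl, le_rfl⟩)

/-- The machine cannot multiply, so row offsets are tabulated once by repeated addition. -/
theorem prepareProgram_ends (T₁ T₂ : OTree Λ) :
    Ends prepareProgram (gapInput a b T₁ T₂) fun t s' => t ≤ 50 * (T₁.size + 1) ∧
      Prepared a b T₁.toForest T₂.toForest s' := by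
  refine .seq (.nset (Ends.mono (Ends.while_loop (τ := 30) (N := T₁.size)
    (fun i s' => ∃ p, p + i = T₁.size ∧ s'.nvar 0 = T₁.size ∧ s'.nvar 1 = T₂.size ∧
      s'.nvar 4 = p ∧ s'.rvar = (gapInput a b T₁ T₂).rvar ∧
      s'.rarr = (gapInput a b T₁ T₂).rarr ∧
      (∀ A < 4, s'.narr A = (gapInput a b T₁ T₂).narr A) ∧
      (∀ j ≤ p, s'.narr 4 j = j * (T₂.size + 1)) ∧ ∀ j ≤ p, s'.narr 5 j = j * T₂.size)
    ?_ ?_ ⟨0, ?_⟩) ?_))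
  · rintro s' ⟨p, hp, h₀, -, h₄, -⟩
    simp [Test.Holds, NExpr.eval, h₀, h₄]
    omega
  · rintro i s' ⟨p, hp, h₀, h₁, h₄, hr, hra, hn, hrow, hrow'⟩
    refine ⟨by simp [Test.Holds, NExpr.eval, h₀, h₄]; omega,
      .seq (.nstore (.seq (.nstore (.nset ⟨?_, p + 1, ?_, ?_, ?_, ?_, hr, hra, ?_, ?_, ?_⟩))))⟩
    · simp [NExpr.time]
    · omega
    · simpa using h₀
    · simpa using h₁
    · simp [NExpr.eval, h₄]
    · intro A hA
      simp [show A ≠ 4 by omega, show A ≠ 5 by omega, hn A hA]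
    · intro j hj
      by_cases hc : j = p + 1
      · simp [NExpr.eval, h₄, h₁, hc, hrow p le_rfl]
        ring
      · simp [NExpr.eval, h₄, hc, hrow j (by omega)]
    · intro j hj
      by_cases hc : j = p + 1
      · simp [NExpr.eval, h₄, h₁, hc, hrow' p le_rfl]
        ring
      · simp [NExpr.eval, h₄, hc, hrow' j (by omega)]
  · refine ⟨Nat.zero_add _, ?_⟩
    simp [gapInput, NExpr.eval]
  · rintro t s' ⟨ht, p, hp, h₀, h₁, -, hr, hra, hn, hrow, hrow'⟩
    rw [Nat.add_zero] at hp
    subst hp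
    refine ⟨?_, h₀, h₁, ?_, ?_, ?_, ?_, ?_, hrow, hrow'⟩
    · simp only [NExpr.time, Test.time] at *
      omega
    · simp [hn, gapInput]
    · simp [hn, gapInput]
    · simp [hr, gapInput]
    · simp [hr, gapInput]
    · simp [hra, gapInput]

theorem gapProgram_ends (T₁ T₂ : OTree Λ) :
    Ends gapProgram (gapInput a b T₁ T₂) fun t s' =>
      t ≤ 6480 * (T₁.size ^ 2 * T₂.size ^ 2) ∧
      s'.rvar 0 = mappingDist a b 0 T₁.toForest 0 T₂.toForest := by
  have hm : 1 ≤ T₁.size := by simp [OTree.size, OTree.toForest, OForest.size]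
  have hn : 1 ≤ T₂.size := by simp [OTree.size, OTree.toForest, OForest.size]
  refine .seq ((prepareProgram_ends T₁ T₂).mono ?_)
  rintro t s ⟨ht, h⟩
  refine .seq ((firstProgram_ends rfl rfl h).mono ?_)
  rintro t' s' ⟨ht', h'⟩
  refine .rset ⟨?_, ?_⟩
  · change t' ≤ 350 * ((T₁.size + 1) * (T₂.size + 1) * (T₂.size + 1) * (T₁.size + 1)) at ht'
    generalize T₁.size = m at *
    generalize T₂.size = n at *
    -- Trees are nonempty, so each factor at most doubles; `16 * 350` and the linear preparation
    -- stay below `6480`.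
    have h₁ : (m + 1) * (n + 1) * (n + 1) * (m + 1) ≤ 2 * m * (2 * n) * (2 * n) * (2 * m) := by
      gcongr <;> omega
    have h₂ : m ≤ m ^ 2 * n ^ 2 := by
      calc m = m ^ 1 * 1 := by ring
        _ ≤ m ^ 2 * n ^ 2 := Nat.mul_le_mul (Nat.pow_le_pow_right hm (by decide))
          (Nat.one_le_pow _ _ hn)
    rw [show 2 * m * (2 * n) * (2 * n) * (2 * m) = 16 * (m ^ 2 * n ^ 2) by ring] at h₁
    simp only [RExpr.time, NExpr.time]
    omega
  · simpa [RExpr.eval, NExpr.eval] using h'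

end Correctness

end RAM

theorem mainTheorem1 :
    ∃ (P : RAM.Program) (C C' : ℕ),
      ∀ (Λ : Type*) [MetricSpace Λ] (a b : ℝ) (T₁ T₂ : OTree Λ),
        0 ≤ a → 0 < b → T₁.IsBinary → T₂.IsBinary →
        ∃ (t : ℕ) (s : RAM.State),
          RAM.Run P (gapInput a b T₁ T₂) t s ∧
          IsGapEditDistance a b T₁ T₂ (s.rvar 0) ∧
          t ≤ C * (T₁.size ^ 3 * T₂.size ^ 2 + T₁.size ^ 2 * T₂.size ^ 3) ∧
          (T₂.size ≤ T₁.size → t ≤ C' * T₁.size ^ 5) := by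
  refine ⟨RAM.gapProgram, 6480, 6480, fun Λ _ a b T₁ T₂ ha hb _ _ => ?_⟩
  obtain ⟨t, s, hrun, ht, hs⟩ := RAM.gapProgram_ends (a := a) (b := b) T₁ T₂
  have hm : 1 ≤ T₁.size := by simp [OTree.size, OTree.toForest, OForest.size]
  refine ⟨t, s, hrun, hs ▸ isGapEditDistance_mappingDist ha hb T₁ T₂, ?_, fun hle => ?_⟩
  -- The bound by the product of the squared sizes is already below the first summand.
  · refine ht.trans (Nat.mul_le_mul_left _ (le_add_right (Nat.mul_le_mul_right _ ?_)))
    exact Nat.pow_le_pow_right hm (by decide)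
  · refine ht.trans (Nat.mul_le_mul_left _ ?_)
    calc T₁.size ^ 2 * T₂.size ^ 2 ≤ T₁.size ^ 2 * T₁.size ^ 2 :=
          Nat.mul_le_mul_left _ (Nat.pow_le_pow_left hle 2)
      _ = T₁.size ^ 4 := by ring
      _ ≤ T₁.size ^ 5 := Nat.pow_le_pow_right hm (by decide)
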